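/- Let $d \ge 1$. For $u : \mathbb{Z}^d \to \mathbb{R}$ let $\Delta u(x) = \sum_{i=1}^d \bigl(u(x+e_i) + u(x-e_i) - 2u(x)\bigr)$ be the discrete Laplacian. For every $p \in \mathbb{R}^d \setminus \{0\}$ there is exactly one function $u : \mathbb{Z}^d \to \mathbb{R}$ such that $\Delta u(x) = 0$ whenever $p\cdot x > 0$, $u(x) = 0$ whenever $p \cdot x \le 0$, and $\sup_{p\cdot x > 0} |u(x) - p\cdot x| < \infty$; the lattice half-space Hamiltonian is $H(p) = \Delta u(0)$ for this $u$. Let $$S(\theta) = \log\Bigl(1 - \frac1d \sum_{j=1}^d \cos\theta_j\Bigr),$$ a $2\pi\mathbb{Z}^d$-periodic function that is integrable on $[-\pi,\pi]^d$, with (real) Fourier coefficients $\hat S(q) = (2\pi)^{-d}\int_{[-\pi,\pi]^d} S(\theta) e^{-i q\cdot\theta}\,d\theta$, $q \in \mathbb{Z}^d$. Then for every $p \in \mathbb{R}^d \setminus \{0\}$ the series below converges absolutely and $$H(p)^2 = 2d \, \exp\Bigl(\sum_{q \in \mathbb{Z}^d,\ p\cdot q = 0} \hat S(q)\Bigr)\,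 |p|^2 .$$ -/

import Mathlib

open MeasureTheory

/-- The pairing `p · x` of a real vector `p ∈ ℝ^d` with a lattice point `x ∈ ℤ^d`. -/
noncomputable def latticeDot {d : ℕ} (p : EuclideanSpace ℝ (Fin d)) (x : Fin d → ℤ) : ℝ :=
  ∑ i, p i * (x i : ℝ)

/-- The discrete Laplacian on `ℤ^d`:
`Δu(x) = ∑ i, (u(x + e_i) + u(x - e_i) - 2 u(x))`. -/
noncomputable def latticeLaplacian {d : ℕ} (u : (Fin d → ℤ) → ℝ) (x : Fin d → ℤ) : ℝ :=
  ∑ i, (u (x + Pi.single i 1) + u (x - Pi.single i 1) - 2 * u x)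

/-- `u : ℤ^d → ℝ` is a half-space solution for the slope `p`: it is harmonic where `p · x > 0`,
it vanishes where `p · x ≤ 0`, and `u(x) - p · x` is bounded on `p · x > 0`. -/
structure IsHalfSpaceSolution {d : ℕ} (p : EuclideanSpace ℝ (Fin d))
    (u : (Fin d → ℤ) → ℝ) : Prop where
  harmonic : ∀ x, 0 < latticeDot p x → latticeLaplacian u x = 0
  eq_zero : ∀ x, latticeDot p x ≤ 0 → u x = 0
  bounded : ∃ C : ℝ, ∀ x, 0 < latticeDot p x → |u x - latticeDot p x| ≤ C

/-- The lattice half-space Hamiltonian `H(p) = Δu(0)`, where `u` is the half-space solution for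
the slope `p` (meaningful when that solution exists and is unique). -/
noncomputable def hamiltonian {d : ℕ} (p : EuclideanSpace ℝ (Fin d)) : ℝ :=
  latticeLaplacian (Classical.epsilon (IsHalfSpaceSolution p)) 0

/-- The `2πℤ^d`-periodic function `S(θ) = log (1 - (1/d) ∑ j, cos θ_j)`. -/
noncomputable def symbolS {d : ℕ} (θ : Fin d → ℝ) : ℝ :=
  Real.log (1 - (1 / (d : ℝ)) * ∑ j, Real.cos (θ j))

/-- The fundamental cell `[-π, π]^d` of `2πℤ^d`. -/
def periodCell (d : ℕ) : Set (Fin d → ℝ) :=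
  Set.Icc (fun _ => -Real.pi) (fun _ => Real.pi)

/-- The (normalized) Fourier coefficient `(2π)^{-d} ∫_{[-π,π]^d} f(θ) e^{-i q·θ} dθ` of a
`2πℤ^d`-periodic function `f`. -/
noncomputable def torusFourierCoeff {d : ℕ} (f : (Fin d → ℝ) → ℂ) (q : Fin d → ℤ) : ℂ :=
  (((2 * Real.pi) ^ d : ℝ) : ℂ)⁻¹ *
    ∫ θ in periodCell d, f θ * Complex.exp (-(Complex.I * ((∑ i, (q i : ℝ) * θ i : ℝ) : ℂ)))

/-- The Fourier coefficients `Ŝ : ℤ^d → ℝ` of `S`. They are real numbers,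
see `ofReal_symbolSHat`. -/
noncomputable def symbolSHat {d : ℕ} (q : Fin d → ℤ) : ℝ :=
  (torusFourierCoeff (fun θ => (symbolS θ : ℂ)) q).re

theorem ofReal_symbolSHat {d : ℕ} (q : Fin d → ℤ) :
    (symbolSHat q : ℂ) = torusFourierCoeff (fun θ => (symbolS θ : ℂ)) q := by
  refine Complex.conj_eq_iff_re.mp ?_
  unfold torusFourierCoeff
  rw [map_mul, map_inv₀, Complex.conj_ofReal, ← integral_conj]
  congr 1
  have hneg : MeasurePreserving (fun θ : Fin d → ℝ => -θ) volume volume :=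
    Measure.measurePreserving_neg volume
  have hpre : (fun θ : Fin d → ℝ => -θ) ⁻¹' periodCell d = periodCell d := by
    ext θ
    simp only [periodCell, Set.mem_preimage, Set.mem_Icc, Pi.le_def, Pi.neg_apply]
    exact ⟨fun h => ⟨fun i => by linarith [h.2 i], fun i => by linarith [h.1 i]⟩,
      fun h => ⟨fun i => by linarith [h.2 i], fun i => by linarith [h.1 i]⟩⟩
  have key := hneg.setIntegral_preimage_emb (MeasurableEquiv.neg (Fin d → ℝ)).measurableEmbedding
    (fun θ : Fin d → ℝ => (symbolS θ : ℂ) *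
      Complex.exp (-(Complex.I * ((∑ i, (q i : ℝ) * θ i : ℝ) : ℂ)))) (periodCell d)
  rw [hpre] at key
  rw [← key]
  congr 1
  funext θ
  rw [map_mul, Complex.conj_ofReal, ← Complex.exp_conj]
  simp [symbolS]

/-- The lattice `Λ_p = {q ∈ ℤ^d : p · q = 0}` of Diophantine conditions satisfied by `p`. -/
def diophantineLattice {d : ℕ} (p : EuclideanSpace ℝ (Fin d)) : Set (Fin d → ℤ) :=
  {q | latticeDot p q = 0}

/-! Let `X_n` be the simple random walk on `ℤ^d`. Its projection `S_n = p · X_n` is a symmetric walk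
on `ℝ` with finitely supported step law `μ` and step variance `|p|²/d`. The half-space solution is
`u(x) = f(p · x)`, where `f` is harmonic for `S` on `(0, ∞)` and vanishes on `(-∞, 0]`. A maximum
principle on strips gives uniqueness among all functions on `ℤ^d`. Hence `H(p) = 2d · E f(S_1)`.
Optional stopping identifies `E f(S_1)` with `m`, minus the mean position of `S` when it first
returns to `(-∞, 0]` (`pairing_eq_ladderMean`).

The mean `m` is computed by Wiener–Hopf factorization. Let `b` be one minus the generating function
of the exit position, with values in the group algebra of `ℝ`, let `b'` be its reflection and let
`c` be the scalar series of the atoms of `b` at `0`. Then `b b' = c (1 - Xμ)`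
(`ladderSeries_mul_map_reflect`). Total masses at `X = 1` show that the exit is almost sure, and
second moments then give `2m² = c(1) |p|²/d`. Logarithmic differentiation of the factorization gives
`c(r) = exp(-∑ P(S_n = 0) r^n / n)`, and Abel's theorem carries this to `r = 1`. Positivity of `m`
makes `c(1)` positive, which forces the series to converge. Therefore `H(p)² = 2d exp(-∑ P(S_n = 0)
/ n) |p|²`.

Finally, `S(θ) = log(1 - φ(θ)) = -∑ φ(θ)^n / n`, where `φ` is the characteristic function of one
step and `φ^n` has Fourier coefficients `P(X_n = q)`. So `Ŝ(q) = -∑ P(X_n = q) / n`, and summing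
over `p · q = 0` turns `P(X_n = q)` into `P(S_n = 0)`. All terms have one sign, so Tonelli justifies
the exchange. -/

/-- The group algebra of the additive group of real numbers: finitely supported (signed) measures
on `ℝ` under convolution. -/
abbrev RealGroupAlgebra : Type := AddMonoidAlgebra ℝ ℝ

/-! ### Positivity of convolutions -/

section ConvolutionPositivity

variable {G : Type*} [AddGroup G]

theorem coeff_mul_nonneg {a b : AddMonoidAlgebra ℝ G} (ha : ∀ y, 0 ≤ a.coeff y)
    (hb : ∀ y, 0 ≤ b.coeff y) (y : G) : 0 ≤ (a * b).coeff y := by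
  rw [AddMonoidAlgebra.coeff_mul_apply_left]
  exact Finset.sum_nonneg fun z _ => mul_nonneg (ha z) (hb _)

theorem coeff_one_nonneg (y : G) : 0 ≤ (1 : AddMonoidAlgebra ℝ G).coeff y := by
  classical
  rw [AddMonoidAlgebra.one_def, AddMonoidAlgebra.coeff_single, Finsupp.single_apply]
  split_ifs <;> norm_num

theorem coeff_pow_nonneg {a : AddMonoidAlgebra ℝ G} (ha : ∀ y, 0 ≤ a.coeff y) (n : ℕ) :
    ∀ y, 0 ≤ (a ^ n).coeff y := by
  induction n with
  | zero => simpa using coeff_one_nonneg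
  | succ n ih => rw [pow_succ]; exact coeff_mul_nonneg ih ha

end ConvolutionPositivity

/-! ### Finitely supported measures on the line: moments, supports, reflection, restriction -/

namespace RealGroupAlgebra

/-- Integration of a function against a finitely supported measure. -/
noncomputable def pairing (f : ℝ → ℝ) : RealGroupAlgebra →ₗ[ℝ] ℝ where
  toFun a := a.coeff.sum fun y r => r * f y
  map_add' a b := by
    rw [AddMonoidAlgebra.coeff_add, Finsupp.sum_add_index'] <;> intros <;> ring
  map_smul' c a := by
    rw [AddMonoidAlgebra.coeff_smul, Finsupp.sum_smul_index' (by simp), RingHom.id_apply,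
      Finsupp.smul_sum]
    simp [mul_assoc]

theorem pairing_apply (f : ℝ → ℝ) (a : RealGroupAlgebra) :
    pairing f a = a.coeff.sum fun y r => r * f y := rfl

@[simp] theorem pairing_single (f : ℝ → ℝ) (y r : ℝ) :
    pairing f (AddMonoidAlgebra.single y r) = r * f y := by
  rw [pairing_apply, AddMonoidAlgebra.coeff_single, Finsupp.sum_single_index (by simp)]

@[simp] theorem pairing_one (f : ℝ → ℝ) : pairing f (1 : RealGroupAlgebra) = f 0 := by
  rw [AddMonoidAlgebra.one_def, pairing_single, one_mul]

theorem pairing_congr {f g : ℝ → ℝ} {a : RealGroupAlgebra}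
    (h : ∀ y, a.coeff y ≠ 0 → f y = g y) : pairing f a = pairing g a := by
  refine Finset.sum_congr rfl fun y hy => ?_
  simp only [h y (Finsupp.mem_support_iff.mp hy)]

theorem pairing_mono {f g : ℝ → ℝ} {a : RealGroupAlgebra} (ha : ∀ y, 0 ≤ a.coeff y)
    (h : ∀ y, a.coeff y ≠ 0 → f y ≤ g y) : pairing f a ≤ pairing g a :=
  Finset.sum_le_sum fun y hy =>
    mul_le_mul_of_nonneg_left (h y (Finsupp.mem_support_iff.mp hy)) (ha y)

theorem pairing_fun_add (f g : ℝ → ℝ) (a : RealGroupAlgebra) :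
    pairing (fun y => f y + g y) a = pairing f a + pairing g a := by
  simp only [pairing_apply, mul_add, Finsupp.sum_add]

theorem pairing_fun_mul (c : ℝ) (f : ℝ → ℝ) (a : RealGroupAlgebra) :
    pairing (fun y => c * f y) a = c * pairing f a := by
  simp only [pairing_apply, Finsupp.mul_sum]
  exact Finset.sum_congr rfl fun y _ => by ring

theorem pairing_const (c : ℝ) (a : RealGroupAlgebra) :
    pairing (fun _ => c) a = c * pairing (fun _ => 1) a := by
  simpa using pairing_fun_mul c (fun _ => 1) a

theorem pairing_nonneg {f : ℝ → ℝ} {a : RealGroupAlgebra} (ha : ∀ y, 0 ≤ a.coeff y)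
    (h : ∀ y, a.coeff y ≠ 0 → 0 ≤ f y) : 0 ≤ pairing f a :=
  Finset.sum_nonneg fun y hy => mul_nonneg (ha y) (h y (Finsupp.mem_support_iff.mp hy))

theorem coeff_le_mass {a : RealGroupAlgebra} (ha : ∀ y, 0 ≤ a.coeff y) (y : ℝ) :
    a.coeff y ≤ pairing (fun _ => 1) a := by
  simp only [pairing_apply, mul_one]
  by_cases h : a.coeff y = 0
  · rw [h]; exact Finset.sum_nonneg fun z _ => ha z
  · exact Finset.single_le_sum (f := fun z => a.coeff z) (fun z _ => ha z)
      (Finsupp.mem_support_iff.mpr h)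

theorem pairing_mul (f : ℝ → ℝ) (a b : RealGroupAlgebra) :
    pairing f (a * b) = pairing (fun y => pairing (fun z => f (y + z)) a) b := by
  induction b using AddMonoidAlgebra.induction_linear with
  | zero => simp
  | add b c hb hc => rw [mul_add, map_add, map_add, hb, hc]
  | single y r =>
    rw [pairing_single]
    induction a using AddMonoidAlgebra.induction_linear with
    | zero => simp
    | add a c ha hc => rw [add_mul, map_add, map_add, ha, hc, mul_add]
    | single z s =>
      rw [AddMonoidAlgebra.single_mul_single, pairing_single, pairing_single, add_comm z y]
      ring

theorem mass_mul (a b : RealGroupAlgebra) :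
    pairing (fun _ => 1) (a * b) = pairing (fun _ => 1) a * pairing (fun _ => 1) b := by
  rw [pairing_mul, pairing_const]

theorem firstMoment_mul (a b : RealGroupAlgebra) :
    pairing (fun y => y) (a * b) = pairing (fun y => y) a * pairing (fun _ => 1) b
      + pairing (fun _ => 1) a * pairing (fun y => y) b := by
  have h : ∀ y : ℝ, pairing (fun z => y + z) a =
      pairing (fun _ => 1) a * y + pairing (fun y => y) a := fun y => by
    rw [pairing_fun_add, pairing_const]
    ring
  rw [pairing_mul]
  simp_rw [h]
  rw [pairing_fun_add, pairing_fun_mul, pairing_const _ b]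
  ring

theorem secondMoment_mul (a b : RealGroupAlgebra) :
    pairing (fun y => y ^ 2) (a * b) = pairing (fun y => y ^ 2) a * pairing (fun _ => 1) b
      + 2 * (pairing (fun y => y) a * pairing (fun y => y) b)
      + pairing (fun _ => 1) a * pairing (fun y => y ^ 2) b := by
  have h : ∀ y : ℝ, pairing (fun z => (y + z) ^ 2) a = pairing (fun _ => 1) a * y ^ 2 +
      (2 * pairing (fun y => y) a * y + pairing (fun y => y ^ 2) a) := fun y => by
    have : (fun z : ℝ => (y + z) ^ 2) = fun z => y ^ 2 + (2 * y * z + z ^ 2) := by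
      funext z; ring
    rw [this, pairing_fun_add, pairing_fun_add, pairing_const, pairing_fun_mul]
    ring
  rw [pairing_mul]
  simp_rw [h]
  rw [pairing_fun_add, pairing_fun_add, pairing_fun_mul, pairing_fun_mul, pairing_const _ b]
  ring

theorem coeff_mul_eq_zero {a b : RealGroupAlgebra} {s t : ℝ} (ha : ∀ y < s, a.coeff y = 0)
    (hb : ∀ y < t, b.coeff y = 0) (y : ℝ) (hy : y < s + t) : (a * b).coeff y = 0 := by
  rw [AddMonoidAlgebra.coeff_mul_apply_left]
  refine Finset.sum_eq_zero fun z _ => ?_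
  rcases lt_or_ge z s with hz | hz
  · simp only [ha z hz, zero_mul]
  · simp only [hb (-z + y) (by linarith), mul_zero]

/-- Two nonnegative numbers add up to `0` only if both vanish. This makes the atom at `0`
multiplicative on measures carried by `[0, ∞)`, which is what allows scalar identities to be
extracted from the factorization. -/
theorem coeff_mul_zero_eq {a b : RealGroupAlgebra} (ha : ∀ y < 0, a.coeff y = 0)
    (hb : ∀ y < 0, b.coeff y = 0) : (a * b).coeff 0 = a.coeff 0 * b.coeff 0 := by
  rw [AddMonoidAlgebra.coeff_mul_apply_left]
  rw [Finsupp.sum, Finset.sum_eq_single 0]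
  · simp
  · intro z _ hz
    rcases lt_or_gt_of_ne hz with h | h
    · simp only [ha z h, zero_mul]
    · simp only [hb (-z + 0) (by linarith), mul_zero]
  · intro h
    simp only [Finsupp.notMem_support_iff.mp h, zero_mul]

/-- The reflection `y ↦ -y` as an endomorphism of the group algebra. -/
noncomputable def reflect : RealGroupAlgebra →+* RealGroupAlgebra :=
  AddMonoidAlgebra.mapDomainRingHom ℝ (-AddMonoidHom.id ℝ : ℝ →+ ℝ)

@[simp] theorem reflect_single (y r : ℝ) :
    reflect (AddMonoidAlgebra.single y r) = AddMonoidAlgebra.single (-y) r := by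
  simp [reflect]

theorem coeff_reflect (a : RealGroupAlgebra) (y : ℝ) : (reflect a).coeff y = a.coeff (-y) := by
  induction a using AddMonoidAlgebra.induction_linear with
  | zero => simp
  | add a b ha hb => simp [map_add, ha, hb]
  | single z r =>
    rw [reflect_single]
    simp only [AddMonoidAlgebra.coeff_single, Finsupp.single_apply, neg_eq_iff_eq_neg]

theorem pairing_reflect (f : ℝ → ℝ) (a : RealGroupAlgebra) :
    pairing f (reflect a) = pairing (fun y => f (-y)) a := by
  induction a using AddMonoidAlgebra.induction_linear with
  | zero => simp
  | add a b ha hb => simp [map_add, ha, hb]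
  | single z r => simp

theorem reflect_reflect (a : RealGroupAlgebra) : reflect (reflect a) = a := by
  ext y; simp [coeff_reflect]

open Classical in
/-- Restriction of a finitely supported measure to a set. -/
noncomputable def restrict (s : Set ℝ) (a : RealGroupAlgebra) : RealGroupAlgebra :=
  .ofCoeff (a.coeff.filter (· ∈ s))

theorem coeff_restrict_of_mem {s : Set ℝ} (a : RealGroupAlgebra) {y : ℝ} (hy : y ∈ s) :
    (restrict s a).coeff y = a.coeff y := by
  simp [restrict, hy]

theorem coeff_restrict_of_notMem {s : Set ℝ} (a : RealGroupAlgebra) {y : ℝ} (hy : y ∉ s) :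
    (restrict s a).coeff y = 0 := by
  simp [restrict, hy]

theorem coeff_restrict_nonneg {s : Set ℝ} {a : RealGroupAlgebra} (ha : ∀ y, 0 ≤ a.coeff y)
    (y : ℝ) : 0 ≤ (restrict s a).coeff y := by
  by_cases hy : y ∈ s
  · rw [coeff_restrict_of_mem a hy]; exact ha y
  · rw [coeff_restrict_of_notMem a hy]

theorem restrict_Ioi_add_restrict_Iic (t : ℝ) (a : RealGroupAlgebra) :
    restrict (Set.Ioi t) a + restrict (Set.Iic t) a = a := by
  ext y
  rw [AddMonoidAlgebra.coeff_add, Finsupp.add_apply]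
  rcases lt_or_ge t y with h | h
  · rw [coeff_restrict_of_mem a (by exact h), coeff_restrict_of_notMem a (by simpa using h),
      add_zero]
  · rw [coeff_restrict_of_notMem a (by simpa using h), coeff_restrict_of_mem a (by exact h),
      zero_add]

end RealGroupAlgebra

/-! ### Formal Wiener–Hopf factorization -/

namespace RealGroupAlgebra

/-- The law at time `n` of the walk with step law `μ` started at `0`, killed when it first returns
to `(-∞, 0]`. -/
noncomputable def aliveLaw (μ : RealGroupAlgebra) : ℕ → RealGroupAlgebra
  | 0 => 1
  | n + 1 => restrict (Set.Ioi 0) (μ * aliveLaw μ n)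

/-- The law of the position at the first return time to `(-∞, 0]`, on the event that this time
equals `n`. -/
noncomputable def exitLaw (μ : RealGroupAlgebra) : ℕ → RealGroupAlgebra
  | 0 => 0
  | n + 1 => restrict (Set.Iic 0) (μ * aliveLaw μ n)

theorem aliveLaw_succ_add_exitLaw_succ (μ : RealGroupAlgebra) (n : ℕ) :
    aliveLaw μ (n + 1) + exitLaw μ (n + 1) = μ * aliveLaw μ n :=
  restrict_Ioi_add_restrict_Iic 0 _

theorem coeff_aliveLaw_nonneg {μ : RealGroupAlgebra} (hμ : ∀ y, 0 ≤ μ.coeff y) (n : ℕ) :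
    ∀ y, 0 ≤ (aliveLaw μ n).coeff y := by
  induction n with
  | zero => exact coeff_one_nonneg
  | succ n ih => exact coeff_restrict_nonneg (coeff_mul_nonneg hμ ih)

theorem coeff_exitLaw_nonneg {μ : RealGroupAlgebra} (hμ : ∀ y, 0 ≤ μ.coeff y) (n : ℕ) (y : ℝ) :
    0 ≤ (exitLaw μ n).coeff y := by
  cases n with
  | zero => simp [exitLaw]
  | succ n => exact coeff_restrict_nonneg (coeff_mul_nonneg hμ (coeff_aliveLaw_nonneg hμ n)) y

theorem coeff_aliveLaw_succ_of_nonpos (μ : RealGroupAlgebra) (n : ℕ) {y : ℝ} (hy : y ≤ 0) :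
    (aliveLaw μ (n + 1)).coeff y = 0 :=
  coeff_restrict_of_notMem _ (by simpa using hy)

theorem coeff_aliveLaw_of_neg (μ : RealGroupAlgebra) (n : ℕ) {y : ℝ} (hy : y < 0) :
    (aliveLaw μ n).coeff y = 0 := by
  cases n with
  | zero =>
    rw [aliveLaw, AddMonoidAlgebra.one_def, AddMonoidAlgebra.coeff_single,
      Finsupp.single_eq_of_ne hy.ne]
  | succ n => exact coeff_aliveLaw_succ_of_nonpos μ n hy.le

theorem coeff_exitLaw_of_pos (μ : RealGroupAlgebra) (n : ℕ) {y : ℝ} (hy : 0 < y) :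
    (exitLaw μ n).coeff y = 0 := by
  cases n with
  | zero => simp [exitLaw]
  | succ n => exact coeff_restrict_of_notMem _ (by simpa using hy)

theorem coeff_exitLaw_of_lt {μ : RealGroupAlgebra} {m : ℝ} (hm : ∀ y, m < |y| → μ.coeff y = 0)
    (n : ℕ) {y : ℝ} (hy : y < -m) : (exitLaw μ n).coeff y = 0 := by
  cases n with
  | zero => simp [exitLaw]
  | succ n =>
    by_cases h : y ∈ Set.Iic (0 : ℝ)
    · rw [exitLaw, coeff_restrict_of_mem _ h]
      refine coeff_mul_eq_zero (s := -m) (t := 0) (fun z hz => hm z ?_)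
        (fun z hz => coeff_aliveLaw_of_neg μ n hz) y (by linarith)
      exact lt_of_lt_of_le (by linarith) (neg_le_abs z)
    · exact coeff_restrict_of_notMem _ h

open PowerSeries

/-- The generating function of `aliveLaw`. -/
noncomputable def aliveSeries (μ : RealGroupAlgebra) : PowerSeries RealGroupAlgebra :=
  mk (aliveLaw μ)

/-- One minus the generating function of `exitLaw`. -/
noncomputable def ladderSeries (μ : RealGroupAlgebra) : PowerSeries RealGroupAlgebra :=
  1 - mk (exitLaw μ)

/-- Each step of the surviving walk either survives or exits; this is that recursion in
generating-function form. -/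
theorem aliveSeries_mul (μ : RealGroupAlgebra) :
    aliveSeries μ * (1 - X * C μ) = ladderSeries μ := by
  ext1 n
  have h : aliveSeries μ * (1 - X * C μ) = aliveSeries μ - X * (C μ * aliveSeries μ) := by ring
  rw [h]
  cases n with
  | zero => simp [aliveSeries, ladderSeries, aliveLaw, exitLaw]
  | succ n =>
    rw [map_sub, coeff_succ_X_mul, coeff_C_mul, aliveSeries, coeff_mk, coeff_mk,
      ← aliveLaw_succ_add_exitLaw_succ, ladderSeries, map_sub, coeff_one, coeff_mk]
    simp

theorem coeff_coeff_ladderSeries_of_pos (μ : RealGroupAlgebra) (n : ℕ) {y : ℝ} (hy : 0 < y) :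
    (coeff n (ladderSeries μ)).coeff y = 0 := by
  rw [ladderSeries, map_sub, coeff_mk, AddMonoidAlgebra.coeff_sub, Finsupp.sub_apply,
    coeff_exitLaw_of_pos μ n hy, coeff_one, sub_zero]
  split_ifs
  · rw [AddMonoidAlgebra.one_def, AddMonoidAlgebra.coeff_single, Finsupp.single_eq_of_ne hy.ne']
  · simp

theorem coeff_coeff_mul_of_neg {F G : PowerSeries RealGroupAlgebra}
    (hF : ∀ n, ∀ y < 0, (coeff n F).coeff y = 0) (hG : ∀ n, ∀ y < 0, (coeff n G).coeff y = 0)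
    (n : ℕ) (y : ℝ) (hy : y < 0) : (coeff n (F * G)).coeff y = 0 := by
  rw [coeff_mul, AddMonoidAlgebra.coeff_sum, Finsupp.finsetSum_apply]
  exact Finset.sum_eq_zero fun ij _ =>
    coeff_mul_eq_zero (s := 0) (t := 0) (hF _) (hG _) y (by simpa using hy)

/-- The atoms at `0` of the coefficients of a power series over the group algebra. -/
noncomputable def atomPart (F : PowerSeries RealGroupAlgebra) : PowerSeries ℝ :=
  mk fun n => (coeff n F).coeff 0

theorem atomPart_mul {F G : PowerSeries RealGroupAlgebra}
    (hF : ∀ n, ∀ y < 0, (coeff n F).coeff y = 0) (hG : ∀ n, ∀ y < 0, (coeff n G).coeff y = 0) :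
    atomPart (F * G) = atomPart F * atomPart G := by
  ext n
  rw [coeff_mul]
  simp only [atomPart, coeff_mk]
  rw [coeff_mul, AddMonoidAlgebra.coeff_sum, Finsupp.finsetSum_apply]
  exact Finset.sum_congr rfl fun ij _ => coeff_mul_zero_eq (hF _) (hG _)

theorem atomPart_add (F G : PowerSeries RealGroupAlgebra) :
    atomPart (F + G) = atomPart F + atomPart G := by
  ext n; simp [atomPart]

theorem atomPart_sub (F G : PowerSeries RealGroupAlgebra) :
    atomPart (F - G) = atomPart F - atomPart G := by
  ext n; simp [atomPart]

theorem atomPart_map_reflect (F : PowerSeries RealGroupAlgebra) :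
    atomPart (map reflect F) = atomPart F := by
  ext n; simp [atomPart, coeff_reflect]

theorem atomPart_derivative (F : PowerSeries RealGroupAlgebra) :
    atomPart (derivative RealGroupAlgebra F) = derivative ℝ (atomPart F) := by
  ext n
  have h : coeff (n + 1) F * ((n : RealGroupAlgebra) + 1) =
      ((n : ℝ) + 1) • coeff (n + 1) F := by
    rw [add_smul, one_smul, mul_add, mul_one, mul_comm, ← nsmul_eq_mul, Nat.cast_smul_eq_nsmul]
  simp only [atomPart, coeff_derivative, coeff_mk, h, AddMonoidAlgebra.coeff_smul_apply,
    smul_eq_mul]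
  ring

/-- A scalar power series, viewed as a power series over the group algebra. -/
noncomputable def scalarSeries : PowerSeries ℝ →+* PowerSeries RealGroupAlgebra :=
  map (algebraMap ℝ RealGroupAlgebra)

theorem atomPart_scalarSeries_mul (c : PowerSeries ℝ) (F : PowerSeries RealGroupAlgebra) :
    atomPart (scalarSeries c * F) = c * atomPart F := by
  ext n
  simp only [atomPart, coeff_mk]
  rw [coeff_mul, coeff_mul, AddMonoidAlgebra.coeff_sum, Finsupp.finsetSum_apply]
  refine Finset.sum_congr rfl fun ij _ => ?_
  rw [scalarSeries, coeff_map, ← Algebra.smul_def, AddMonoidAlgebra.coeff_smul_apply, coeff_mk,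
    smul_eq_mul]

theorem derivative_scalarSeries (c : PowerSeries ℝ) :
    derivative RealGroupAlgebra (scalarSeries c) = scalarSeries (derivative ℝ c) := by
  ext1 n
  simp only [scalarSeries, coeff_derivative, coeff_map, map_mul, map_add, map_natCast, map_one]

theorem eq_scalarSeries_of_support {F : PowerSeries RealGroupAlgebra}
    (h : ∀ n, ∀ y ≠ 0, (coeff n F).coeff y = 0) : F = scalarSeries (atomPart F) := by
  ext n y
  rw [scalarSeries, coeff_map, atomPart, coeff_mk, AddMonoidAlgebra.coe_algebraMap]
  simp only [Function.comp_apply, Algebra.algebraMap_self, RingHom.id_apply,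
    AddMonoidAlgebra.coeff_single]
  rcases eq_or_ne y 0 with rfl | hy
  · simp
  · rw [h n y hy, Finsupp.single_eq_of_ne hy]

/-- The killing set contains `0`, so the only surviving mass at the origin is the initial one. -/
theorem atomPart_aliveSeries (μ : RealGroupAlgebra) : atomPart (aliveSeries μ) = 1 := by
  ext n
  rw [atomPart, coeff_mk, aliveSeries, coeff_mk, coeff_one]
  cases n with
  | zero => simp [aliveLaw, AddMonoidAlgebra.coeff_one_zero]
  | succ n => simp [coeff_aliveLaw_succ_of_nonpos μ n le_rfl]

theorem map_reflect_map_reflect (F : PowerSeries RealGroupAlgebra) :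
    map reflect (map reflect F) = F := by
  ext1 n; simp [reflect_reflect]

section Symmetric

variable {μ : RealGroupAlgebra}

theorem map_reflect_one_sub (hμ : reflect μ = μ) :
    map reflect (1 - X * C μ) = 1 - X * C μ := by
  simp [hμ]

theorem map_reflect_aliveSeries_mul (hμ : reflect μ = μ) :
    map reflect (aliveSeries μ) * (1 - X * C μ) = map reflect (ladderSeries μ) := by
  rw [← aliveSeries_mul, map_mul, map_reflect_one_sub hμ]

theorem coeff_coeff_aliveSeries_of_neg (μ : RealGroupAlgebra) (n : ℕ) (y : ℝ) (hy : y < 0) :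
    (coeff n (aliveSeries μ)).coeff y = 0 := by
  rw [aliveSeries, coeff_mk]; exact coeff_aliveLaw_of_neg μ n hy

theorem coeff_coeff_map_reflect_ladderSeries_of_neg (μ : RealGroupAlgebra) (n : ℕ) (y : ℝ)
    (hy : y < 0) : (coeff n (map reflect (ladderSeries μ))).coeff y = 0 := by
  rw [coeff_map, coeff_reflect]
  exact coeff_coeff_ladderSeries_of_pos μ n (by linarith)

/-- By the recursion the left side equals `V V' (1 - Xμ)`, with `V` the alive series and `V'` its
reflection, so it is invariant under reflection. Both of its factors are carried by `[0, ∞)`. A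
symmetric measure carried by `[0, ∞)` sits at `0`, and its atom is the product of the atoms. -/
theorem aliveSeries_mul_map_reflect_ladderSeries (hμ : reflect μ = μ) :
    aliveSeries μ * map reflect (ladderSeries μ) = scalarSeries (atomPart (ladderSeries μ)) := by
  set F := aliveSeries μ * map reflect (ladderSeries μ) with hF
  have hsymm : map reflect F = F := by
    rw [hF, map_mul, map_reflect_map_reflect, ← map_reflect_aliveSeries_mul hμ, ← aliveSeries_mul]
    ring
  have hneg : ∀ n, ∀ y < 0, (coeff n F).coeff y = 0 :=
    coeff_coeff_mul_of_neg (coeff_coeff_aliveSeries_of_neg μ)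
      (coeff_coeff_map_reflect_ladderSeries_of_neg μ)
  have hsupp : ∀ n, ∀ y ≠ 0, (coeff n F).coeff y = 0 := fun n y hy => by
    rcases lt_or_gt_of_ne hy with h | h
    · exact hneg n y h
    · rw [← hsymm, coeff_map, coeff_reflect]
      exact hneg n (-y) (by linarith)
  rw [eq_scalarSeries_of_support hsupp, hF, atomPart_mul (coeff_coeff_aliveSeries_of_neg μ)
    (coeff_coeff_map_reflect_ladderSeries_of_neg μ), atomPart_aliveSeries, one_mul,
    atomPart_map_reflect]

/-- The Wiener–Hopf factorization of a symmetric step law. -/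
theorem ladderSeries_mul_map_reflect (hμ : reflect μ = μ) :
    ladderSeries μ * map reflect (ladderSeries μ) =
      scalarSeries (atomPart (ladderSeries μ)) * (1 - X * C μ) := by
  rw [← aliveSeries_mul_map_reflect_ladderSeries hμ]
  nth_rewrite 1 [← aliveSeries_mul]
  ring

/-- The generating function `∑ n, μ ^ n X ^ n`. -/
noncomputable def greenSeries (μ : RealGroupAlgebra) : PowerSeries RealGroupAlgebra :=
  mk fun n => μ ^ n

theorem one_sub_mul_greenSeries (μ : RealGroupAlgebra) :
    (1 - X * C μ) * greenSeries μ = 1 := by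
  ext1 n
  have h : (1 - X * C μ) * greenSeries μ = greenSeries μ - X * (C μ * greenSeries μ) := by ring
  rw [h]
  cases n with
  | zero => simp [greenSeries]
  | succ n =>
    rw [map_sub, coeff_succ_X_mul, coeff_C_mul, greenSeries, coeff_mk, coeff_mk, pow_succ',
      sub_self, coeff_one, if_neg n.succ_ne_zero]

theorem constantCoeff_atomPart_ladderSeries (μ : RealGroupAlgebra) :
    constantCoeff (atomPart (ladderSeries μ)) = 1 := by
  rw [← coeff_zero_eq_constantCoeff_apply, atomPart, coeff_mk]
  simp [ladderSeries, exitLaw, AddMonoidAlgebra.coeff_one_zero]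

/-- This is the differential form of `c = exp(-∑ (μ ^ n).coeff 0 X^n / n)`. It comes from
differentiating `b b' = c (1 - Xμ)` in `X`, dividing by the product and comparing atoms at `0`. -/
theorem derivative_atomPart_ladderSeries (hμ : reflect μ = μ) :
    derivative ℝ (atomPart (ladderSeries μ)) =
      -(atomPart (ladderSeries μ) * mk fun n => (μ ^ (n + 1)).coeff 0) := by
  set c := atomPart (ladderSeries μ) with hc
  set b := ladderSeries μ with hb
  set V := aliveSeries μ with hV
  set b' := map reflect b with hb'
  set V' := map reflect V with hV'
  set A : PowerSeries RealGroupAlgebra := 1 - X * C μ with hA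
  set D := derivative RealGroupAlgebra
  set s := scalarSeries c with hs
  have h1 : V * A = b := aliveSeries_mul μ
  have h2 : V' * A = b' := map_reflect_aliveSeries_mul hμ
  have h3 : V * b' = s := aliveSeries_mul_map_reflect_ladderSeries hμ
  have h4 : A * greenSeries μ = 1 := one_sub_mul_greenSeries μ
  have hDA : D A = -C μ := by
    rw [hA, map_sub, Derivation.leibniz]
    simp [D]
  have hDs : D s = scalarSeries (derivative ℝ c) := derivative_scalarSeries c
  have hunit : IsUnit s := by
    refine IsUnit.map scalarSeries (isUnit_iff_constantCoeff.mpr ?_)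
    rw [hc, constantCoeff_atomPart_ladderSeries]
    exact isUnit_one
  have h5 : D b * b' + b * D b' = D s * A - s * C μ := by
    have := congrArg D (ladderSeries_mul_map_reflect hμ)
    rw [Derivation.leibniz, Derivation.leibniz, hDA] at this
    simp only [smul_eq_mul] at this
    linear_combination this
  -- Multiplying `h5` by `V V'` replaces `V b'` and `V' b` by `s`, and `V V'` by `s` times the Green
  -- series; the invertible `s` then cancels.
  have h6 : D b * V' + V * D b' = scalarSeries (derivative ℝ c) - s * (greenSeries μ * C μ) := by
    rw [← hDs]
    refine hunit.mul_left_cancel ?_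
    have e1 : V' * b = s := by rw [← h3, ← h1, ← h2]; ring
    have e2 : V * V' = s * greenSeries μ := by
      linear_combination (-(V * V')) * h4 + greenSeries μ * (V * h2 + h3)
    have e3 : A * (V * V') = s := by linear_combination V * h2 + h3
    linear_combination (V * V') * h5 - (D b * V') * h3 - (V * D b') * e1 + D s * e3 -
      s * C μ * e2
  have hbneg : ∀ n, ∀ y < 0, (coeff n b').coeff y = 0 :=
    coeff_coeff_map_reflect_ladderSeries_of_neg μ
  have hDneg : ∀ n, ∀ y < 0, (coeff n (D b')).coeff y = 0 := fun n y hy => by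
    rw [coeff_derivative]
    refine coeff_mul_eq_zero (s := 0) (t := 0) (hbneg (n + 1)) (fun z hz => ?_) y
      (by simpa using hy)
    rw [← Nat.cast_succ, AddMonoidAlgebra.coeff_natCast, Finsupp.single_eq_of_ne hz.ne]
  have h7 : atomPart (V * D b') = derivative ℝ c := by
    rw [atomPart_mul (coeff_coeff_aliveSeries_of_neg μ) hDneg, atomPart_aliveSeries, one_mul,
      atomPart_derivative, atomPart_map_reflect]
  have h8 : map reflect (D b') = D b := by
    have : map reflect b' = b := map_reflect_map_reflect b
    rw [← this]
    ext1 n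
    simp [D, coeff_derivative]
  have h9 : atomPart (D b * V') = derivative ℝ c := by
    rw [← h7, ← atomPart_map_reflect (V * D b'), map_mul, h8, mul_comm]
  have h10 : atomPart (greenSeries μ * C μ) = mk fun n => (μ ^ (n + 1)).coeff 0 := by
    ext n
    rw [atomPart, coeff_mk, coeff_mul_C, greenSeries, coeff_mk, coeff_mk, pow_succ]
  -- The two terms on the left are reflections of each other and each has atom series `c'`. Hence
  -- `2c' = c' - c · (…)`, which determines `c'`.
  have h11 := congrArg atomPart h6
  rw [atomPart_add, atomPart_sub, h7, h9, atomPart_scalarSeries_mul, h10,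
    ← mul_one (scalarSeries _), atomPart_scalarSeries_mul] at h11
  have h12 : atomPart (1 : PowerSeries RealGroupAlgebra) = 1 := by
    ext n
    rw [atomPart, coeff_mk, coeff_one, coeff_one]
    split_ifs <;> simp [AddMonoidAlgebra.coeff_one_zero]
  rw [h12] at h11
  linear_combination h11

end Symmetric

end RealGroupAlgebra

/-! ### Real power series: termwise derivatives and Cauchy products -/

open Filter Topology in
/-- Termwise differentiation of a power series with bounded coefficients. -/
theorem hasDerivAt_tsum_mul_pow {a : ℕ → ℝ} {M : ℝ} (ha : ∀ n, |a n| ≤ M) {r : ℝ}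
    (hr : |r| < 1) :
    HasDerivAt (fun x => ∑' n, a n * x ^ n) (∑' n, a (n + 1) * (n + 1) * r ^ n) r := by
  obtain ⟨ρ, hrρ, hρ⟩ := exists_between hr
  have hρ0 : 0 < ρ := (abs_nonneg r).trans_lt hrρ
  have hρn : ‖ρ‖ < 1 := by rwa [Real.norm_of_nonneg hρ0.le]
  have hM : 0 ≤ M := (abs_nonneg _).trans (ha 0)
  have hu : Summable fun n : ℕ => M * (n * ρ ^ (n - 1)) := by
    refine Summable.mul_left M ((summable_nat_add_iff 1).mp ?_)
    have h1 := summable_pow_mul_geometric_of_norm_lt_one 1 hρn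
    have h0 := summable_geometric_of_norm_lt_one hρn
    refine (h1.add h0).congr fun n => ?_
    push_cast
    ring
  have hbound : ∀ n : ℕ, ∀ y ∈ Set.Ioo (-ρ) ρ, ‖a n * (n * y ^ (n - 1))‖ ≤ M * (n * ρ ^ (n - 1)) := by
    intro n y hy
    rw [norm_mul, norm_mul, norm_pow, Real.norm_eq_abs, Real.norm_eq_abs, Nat.abs_cast]
    have : ‖y‖ ≤ ρ := (abs_lt.mpr hy).le
    gcongr
    exact ha n
  have hderiv := hasDerivAt_tsum_of_isPreconnected (g := fun n x => a n * x ^ n)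
    (g' := fun n x => a n * (n * x ^ (n - 1))) (y₀ := 0) hu isOpen_Ioo isPreconnected_Ioo
    (fun n y _ => (hasDerivAt_pow n y).const_mul (a n)) hbound ⟨by linarith, hρ0⟩
    (summable_of_ne_finset_zero (s := {0}) fun n hn => by
      simp only [Finset.mem_singleton] at hn; simp [hn]) (abs_lt.mp hrρ)
  have hs : Summable fun n : ℕ => a n * (n * r ^ (n - 1)) :=
    Summable.of_norm_bounded hu fun n => hbound n r (abs_lt.mp hrρ)
  rw [hs.tsum_eq_zero_add] at hderiv
  convert! hderiv using 1
  simp [mul_assoc]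

theorem summable_abs_mul_pow {a : ℕ → ℝ} {M : ℝ} (ha : ∀ n, |a n| ≤ M) {r : ℝ}
    (hr : |r| < 1) : Summable fun n => |a n * r ^ n| := by
  have hr' : ‖|r|‖ < 1 := by simpa using hr
  refine Summable.of_nonneg_of_le (fun n => abs_nonneg _) (fun n => ?_)
    ((summable_geometric_of_norm_lt_one hr').mul_left M)
  rw [abs_mul, abs_pow]
  exact mul_le_mul_of_nonneg_right (ha n) (by positivity)

theorem hasSum_sum_antidiagonal_of_summable_abs {a b : ℕ → ℝ} (ha : Summable fun n => |a n|)
    (hb : Summable fun n => |b n|) :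
    HasSum (fun n => ∑ kl ∈ Finset.HasAntidiagonal.antidiagonal n, a kl.1 * b kl.2)
      ((∑' n, a n) * ∑' n, b n) := by
  rw [tsum_mul_tsum_eq_tsum_sum_antidiagonal_of_summable_norm (f := a) (g := b) ha hb]
  exact (summable_norm_sum_mul_antidiagonal_of_summable_norm (f := a) (g := b)
    ha hb).of_norm.hasSum

/-! ### Evaluation at `X = 1`: ladder moments and Spitzer's formula -/

namespace RealGroupAlgebra
open PowerSeries Filter Topology

/-- A symmetric probability measure with finite support on `ℝ`. -/
structure IsSymmetricStep (μ : RealGroupAlgebra) : Prop where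
  nonneg : ∀ y, 0 ≤ μ.coeff y
  mass : pairing (fun _ => 1) μ = 1
  reflect_eq : reflect μ = μ

variable {μ : RealGroupAlgebra}

theorem IsSymmetricStep.firstMoment (hμ : IsSymmetricStep μ) : pairing (fun y => y) μ = 0 := by
  have h := pairing_reflect (fun y => y) μ
  rw [hμ.reflect_eq] at h
  have h' := pairing_fun_mul (-1) (fun y => y) μ
  simp only [neg_mul, one_mul] at h'
  linarith

theorem mass_pow (hμ : IsSymmetricStep μ) (n : ℕ) : pairing (fun _ => 1) (μ ^ n) = 1 := by
  induction n with
  | zero => simp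
  | succ n ih => rw [pow_succ, mass_mul, ih, hμ.mass, one_mul]

theorem coeff_pow_le_one (hμ : IsSymmetricStep μ) (n : ℕ) (y : ℝ) : (μ ^ n).coeff y ≤ 1 :=
  (coeff_le_mass (coeff_pow_nonneg hμ.nonneg n) y).trans_eq (mass_pow hμ n)

theorem sum_exitLaw_mass (hμ : IsSymmetricStep μ) (n : ℕ) :
    ∑ k ∈ Finset.range (n + 1), pairing (fun _ => 1) (exitLaw μ k) =
      1 - pairing (fun _ => 1) (aliveLaw μ n) := by
  induction n with
  | zero => simp [exitLaw, aliveLaw]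
  | succ n ih =>
    have h := congrArg (pairing fun _ => 1) (aliveLaw_succ_add_exitLaw_succ μ n)
    rw [map_add, mass_mul, hμ.mass] at h
    rw [Finset.sum_range_succ, ih]
    linarith

theorem exitLaw_mass_nonneg (hμ : IsSymmetricStep μ) (n : ℕ) :
    0 ≤ pairing (fun _ => 1) (exitLaw μ n) :=
  pairing_nonneg (coeff_exitLaw_nonneg hμ.nonneg n) fun _ _ => zero_le_one

theorem summable_exitLaw_mass (hμ : IsSymmetricStep μ) :
    Summable fun n => pairing (fun _ => 1) (exitLaw μ n) := by
  refine summable_of_sum_range_le (c := 1) (exitLaw_mass_nonneg hμ) fun n => ?_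
  refine (Finset.sum_le_sum_of_subset_of_nonneg (Finset.range_mono n.le_succ)
    fun k _ _ => exitLaw_mass_nonneg hμ k).trans ?_
  rw [sum_exitLaw_mass hμ]
  have : 0 ≤ pairing (fun _ => 1) (aliveLaw μ n) :=
    pairing_nonneg (coeff_aliveLaw_nonneg hμ.nonneg n) fun _ _ => zero_le_one
  linarith

theorem exists_support_bound (μ : RealGroupAlgebra) :
    ∃ m : ℝ, 0 ≤ m ∧ ∀ y, m < |y| → μ.coeff y = 0 := by
  refine ⟨∑ y ∈ μ.coeff.support, |y|, Finset.sum_nonneg fun _ _ => abs_nonneg _, fun y hy => ?_⟩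
  by_contra h
  exact absurd (Finset.single_le_sum (f := fun y : ℝ => |y|) (fun _ _ => abs_nonneg _)
    (Finsupp.mem_support_iff.mpr h)) (not_le.mpr hy)

/-- The walk exits from `[0, ∞)` by a step of length at most `m`, so its exit position lies in the
compact interval `[-m, 0]`, on which `f` is bounded. The exit masses sum to at most `1`. -/
theorem summable_abs_pairing_exitLaw (hμ : IsSymmetricStep μ) {f : ℝ → ℝ} (hf : Continuous f) :
    Summable fun n => |pairing f (exitLaw μ n)| := by
  obtain ⟨m, _, hm⟩ := exists_support_bound μ
  obtain ⟨K, hK⟩ := (isCompact_Icc (a := -m) (b := (0 : ℝ))).exists_bound_of_continuousOn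
    hf.continuousOn
  refine Summable.of_nonneg_of_le (fun _ => abs_nonneg _) (fun n => ?_)
    ((summable_exitLaw_mass hμ).mul_left K)
  have hmem : ∀ y, (exitLaw μ n).coeff y ≠ 0 → |f y| ≤ K := fun y hy =>
    hK y ⟨not_lt.mp fun h => hy (coeff_exitLaw_of_lt hm n h),
      not_lt.mp fun h => hy (coeff_exitLaw_of_pos μ n h)⟩
  rw [← pairing_const, abs_le]
  constructor
  · rw [neg_le, ← neg_one_mul, ← pairing_fun_mul]
    exact pairing_mono (coeff_exitLaw_nonneg hμ.nonneg n)
      fun y hy => by linarith [neg_abs_le (f y), hmem y hy]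
  · exact pairing_mono (coeff_exitLaw_nonneg hμ.nonneg n)
      fun y hy => (le_abs_self _).trans (hmem y hy)

theorem pairing_coeff_ladderSeries (μ : RealGroupAlgebra) (f : ℝ → ℝ) (n : ℕ) :
    pairing f (coeff n (ladderSeries μ)) =
      (if n = 0 then f 0 else 0) - pairing f (exitLaw μ n) := by
  rw [ladderSeries, map_sub, coeff_mk, map_sub, coeff_one]
  split_ifs <;> simp

theorem summable_abs_pairing_ladderSeries (hμ : IsSymmetricStep μ) {f : ℝ → ℝ}
    (hf : Continuous f) : Summable fun n => |pairing f (coeff n (ladderSeries μ))| := by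
  have h : Summable fun n : ℕ => |if n = 0 then f 0 else 0| :=
    summable_of_ne_finset_zero (s := {0}) fun n hn => by
      simp only [Finset.mem_singleton] at hn; simp [hn]
  refine Summable.of_nonneg_of_le (fun _ => abs_nonneg _) (fun n => ?_)
    (h.add (summable_abs_pairing_exitLaw hμ hf))
  rw [pairing_coeff_ladderSeries]
  exact abs_sub _ _

theorem coeff_atomPart_ladderSeries (μ : RealGroupAlgebra) (n : ℕ) :
    coeff n (atomPart (ladderSeries μ)) =
      (if n = 0 then 1 else 0) - (exitLaw μ n).coeff 0 := by
  rw [atomPart, coeff_mk, ladderSeries, map_sub, coeff_mk, coeff_one,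
    AddMonoidAlgebra.coeff_sub, Finsupp.sub_apply]
  split_ifs <;> simp [AddMonoidAlgebra.coeff_one_zero]

theorem summable_exitLaw_atom (hμ : IsSymmetricStep μ) :
    Summable fun n => (exitLaw μ n).coeff 0 :=
  Summable.of_nonneg_of_le (fun n => coeff_exitLaw_nonneg hμ.nonneg n 0)
    (fun n => coeff_le_mass (coeff_exitLaw_nonneg hμ.nonneg n) 0) (summable_exitLaw_mass hμ)

theorem summable_atomPart_ladderSeries (hμ : IsSymmetricStep μ) :
    Summable fun n => coeff n (atomPart (ladderSeries μ)) := by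
  simp_rw [coeff_atomPart_ladderSeries]
  exact (summable_of_ne_finset_zero (s := {0}) fun n hn => by
      simp only [Finset.mem_singleton] at hn; simp [hn]).sub (summable_exitLaw_atom hμ)

theorem tsum_pairing_coeff_scalarSeries_mul {c : PowerSeries ℝ}
    (hc : Summable fun n => coeff n c) (f : ℝ → ℝ) (μ : RealGroupAlgebra) :
    ∑' n, pairing f (coeff n (scalarSeries c * (1 - X * C μ))) =
      (∑' n, coeff n c) * (f 0 - pairing f μ) := by
  have h : scalarSeries c * (1 - X * C μ) = scalarSeries c - X * (scalarSeries c * C μ) := by ring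
  have hs : ∀ n, pairing f (coeff n (scalarSeries c)) = coeff n c * f 0 := fun n => by
    rw [scalarSeries, coeff_map, Algebra.algebraMap_eq_smul_one, map_smul, pairing_one,
      smul_eq_mul]
  have hx : ∀ n, pairing f (coeff (n + 1) (X * (scalarSeries c * C μ))) =
      coeff n c * pairing f μ := fun n => by
    rw [coeff_succ_X_mul, coeff_mul_C, scalarSeries, coeff_map, ← Algebra.smul_def, map_smul,
      smul_eq_mul]
  have hx0 : pairing f (coeff 0 (X * (scalarSeries c * C μ))) = 0 := by
    rw [coeff_zero_X_mul, map_zero]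
  have hsum : Summable fun n => pairing f (coeff n (X * (scalarSeries c * C μ))) := by
    refine (summable_nat_add_iff 1).mp ?_
    simp_rw [hx]
    exact hc.mul_right _
  simp_rw [h, map_sub]
  rw [Summable.tsum_sub (by simp_rw [hs]; exact hc.mul_right _) hsum, hsum.tsum_eq_zero_add, hx0]
  simp_rw [hs, hx]
  rw [tsum_mul_right, tsum_mul_right]
  ring

/-- The walk returns to `(-∞, 0]` almost surely: taking masses in the factorization at `X = 1`, the
square of this sum is `c(1) (1 - 1) = 0`. -/
theorem tsum_mass_ladderSeries (hμ : IsSymmetricStep μ) :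
    ∑' n, pairing (fun _ => 1) (coeff n (ladderSeries μ)) = 0 := by
  have hs := summable_abs_pairing_ladderSeries hμ (f := fun _ => 1) continuous_const
  have h := (hasSum_sum_antidiagonal_of_summable_abs hs hs).tsum_eq
  have h2 : ∀ n, ∑ kl ∈ Finset.HasAntidiagonal.antidiagonal n,
      pairing (fun _ => 1) (coeff kl.1 (ladderSeries μ)) *
        pairing (fun _ => 1) (coeff kl.2 (ladderSeries μ)) =
      pairing (fun _ => 1) (coeff n (scalarSeries (atomPart (ladderSeries μ)) *
        (1 - X * C μ))) := fun n => by
    rw [← ladderSeries_mul_map_reflect hμ.reflect_eq, coeff_mul, map_sum]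
    exact Finset.sum_congr rfl fun kl _ => by rw [mass_mul, coeff_map, pairing_reflect]
  simp_rw [h2] at h
  rw [tsum_pairing_coeff_scalarSeries_mul (summable_atomPart_ladderSeries hμ), hμ.mass, sub_self,
    mul_zero] at h
  exact mul_self_eq_zero.mp h.symm

/-- Second moments are taken in the factorization at `X = 1`. The terms with a second moment of one
factor carry the vanishing mass of the other. The cross term is `-2` times the square of the first
moment, since reflection changes its sign. -/
theorem two_mul_sq_tsum_firstMoment_ladderSeries (hμ : IsSymmetricStep μ) :
    2 * (∑' n, pairing (fun y => y) (coeff n (ladderSeries μ))) ^ 2 =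
      (∑' n, coeff n (atomPart (ladderSeries μ))) * pairing (fun y => y ^ 2) μ := by
  have hs0 := summable_abs_pairing_ladderSeries hμ (f := fun _ => 1) continuous_const
  have hs1 := summable_abs_pairing_ladderSeries hμ (f := fun y => y) continuous_id
  have hs2 := summable_abs_pairing_ladderSeries hμ (f := fun y => y ^ 2) (continuous_pow 2)
  have h20 := hasSum_sum_antidiagonal_of_summable_abs hs2 hs0
  have h02 := hasSum_sum_antidiagonal_of_summable_abs hs0 hs2
  have h11 := hasSum_sum_antidiagonal_of_summable_abs hs1 hs1
  rw [tsum_mass_ladderSeries hμ, mul_zero] at h20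
  rw [tsum_mass_ladderSeries hμ, zero_mul] at h02
  have key := tsum_pairing_coeff_scalarSeries_mul (summable_atomPart_ladderSeries hμ)
    (fun y => y ^ 2) μ
  have hneg : ∀ a, pairing (fun y => -y) a = -pairing (fun y => y) a := fun a => by
    simpa using pairing_fun_mul (-1) (fun y => y) a
  have hcoeff : ∀ n, pairing (fun y => y ^ 2) (coeff n (scalarSeries (atomPart (ladderSeries μ)) *
        (1 - X * C μ))) =
      (∑ kl ∈ Finset.HasAntidiagonal.antidiagonal n, pairing (fun y => y ^ 2) (coeff kl.1 (ladderSeries μ)) *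
        pairing (fun _ => 1) (coeff kl.2 (ladderSeries μ)) +
      ∑ kl ∈ Finset.HasAntidiagonal.antidiagonal n, pairing (fun _ => 1) (coeff kl.1 (ladderSeries μ)) *
        pairing (fun y => y ^ 2) (coeff kl.2 (ladderSeries μ))) -
      2 * ∑ kl ∈ Finset.HasAntidiagonal.antidiagonal n, pairing (fun y => y) (coeff kl.1 (ladderSeries μ)) *
        pairing (fun y => y) (coeff kl.2 (ladderSeries μ)) := fun n => by
    rw [← ladderSeries_mul_map_reflect hμ.reflect_eq, coeff_mul, map_sum, Finset.mul_sum,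
      ← Finset.sum_add_distrib, ← Finset.sum_sub_distrib]
    refine Finset.sum_congr rfl fun kl _ => ?_
    rw [secondMoment_mul, coeff_map, pairing_reflect, pairing_reflect, pairing_reflect, hneg]
    simp only [neg_sq]
    ring
  simp_rw [hcoeff] at key
  rw [((h20.add h02).sub (h11.mul_left 2)).tsum_eq] at key
  linear_combination -key

theorem abs_coeff_atomPart_le (hμ : IsSymmetricStep μ) (n : ℕ) :
    |coeff n (atomPart (ladderSeries μ))| ≤ 2 := by
  have h0 := coeff_exitLaw_nonneg hμ.nonneg n 0
  have h1 : (exitLaw μ n).coeff 0 ≤ 1 := by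
    refine (coeff_le_mass (coeff_exitLaw_nonneg hμ.nonneg n) 0).trans ?_
    have h2 := Finset.single_le_sum (fun k _ => exitLaw_mass_nonneg hμ k)
      (Finset.self_mem_range_succ n)
    rw [sum_exitLaw_mass hμ] at h2
    have : 0 ≤ pairing (fun _ => 1) (aliveLaw μ n) :=
      pairing_nonneg (coeff_aliveLaw_nonneg hμ.nonneg n) fun _ _ => zero_le_one
    linarith
  rw [coeff_atomPart_ladderSeries, abs_le]
  split_ifs <;> constructor <;> linarith

/-- The exponential formula for the generating function of the return to `0` through the positive
half-line. -/
theorem tsum_atomPart_mul_pow_eq_exp (hμ : IsSymmetricStep μ) {r : ℝ} (hr0 : 0 ≤ r) (hr : r < 1) :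
    ∑' n, coeff n (atomPart (ladderSeries μ)) * r ^ n =
      Real.exp (-∑' n : ℕ, (μ ^ n).coeff 0 / n * r ^ n) := by
  set c : ℕ → ℝ := fun n => coeff n (atomPart (ladderSeries μ)) with hc
  -- Division by zero makes `g 0 = 0`, so the sum over all `n` is the usual sum over `n ≥ 1`.
  set g : ℕ → ℝ := fun n => (μ ^ n).coeff 0 / n with hg
  have hcb : ∀ n, |c n| ≤ 2 := abs_coeff_atomPart_le hμ
  have hpb : ∀ n, |(μ ^ n).coeff 0| ≤ 1 := fun n => by
    rw [abs_of_nonneg (coeff_pow_nonneg hμ.nonneg n 0)]; exact coeff_pow_le_one hμ n 0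
  have hgb : ∀ n, |g n| ≤ 1 := fun n => by
    rw [hg, abs_div, Nat.abs_cast]
    rcases n.eq_zero_or_pos with rfl | hn
    · simp
    · have hn1 : (1 : ℝ) ≤ n := by exact_mod_cast hn
      rw [div_le_one (by linarith)]
      exact (hpb n).trans hn1
  have hodd : ∀ n, c (n + 1) * (n + 1) =
      -∑ kl ∈ Finset.HasAntidiagonal.antidiagonal n, c kl.1 * (g (kl.2 + 1) * (kl.2 + 1)) := fun n => by
    have h := congrArg (coeff n) (derivative_atomPart_ladderSeries hμ.reflect_eq)
    rw [coeff_derivative, map_neg, coeff_mul] at h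
    rw [hc, h]
    congr 1
    refine Finset.sum_congr rfl fun kl _ => ?_
    rw [coeff_mk, hg]
    push_cast
    rw [div_mul_cancel₀ _ (by positivity)]
  -- The differential equation for `c` says that `c(x) exp(g(x))` is constant on `(-1, 1)`; its
  -- value at `0` is `1`.
  have hderiv : ∀ x : ℝ, |x| < 1 → HasDerivAt
      (fun x => (∑' n, c n * x ^ n) * Real.exp (∑' n, g n * x ^ n)) 0 x := fun x hx => by
    have h1 := hasDerivAt_tsum_mul_pow hcb hx
    have h2 := hasDerivAt_tsum_mul_pow hgb hx
    have hgb' : ∀ n : ℕ, |g (n + 1) * (n + 1)| ≤ 1 := fun n => by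
      rw [hg]
      push_cast
      rw [div_mul_cancel₀ _ (by positivity)]
      exact hpb _
    have h3 := hasSum_sum_antidiagonal_of_summable_abs
      (summable_abs_mul_pow hcb hx) (summable_abs_mul_pow hgb' hx)
    have h4 : ∑' n : ℕ, c (n + 1) * (n + 1) * x ^ n =
        -((∑' n, c n * x ^ n) * ∑' n : ℕ, g (n + 1) * (n + 1) * x ^ n) := by
      rw [← h3.tsum_eq, ← tsum_neg]
      refine tsum_congr fun n => ?_
      rw [hodd, neg_mul, Finset.sum_mul]
      congr 1
      refine Finset.sum_congr rfl fun kl hkl => ?_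
      rw [← Finset.HasAntidiagonal.mem_antidiagonal.mp hkl, pow_add]
      ring
    convert! h1.mul h2.exp using 1
    rw [h4]
    ring
  have hconst := (convex_Ioo (-1 : ℝ) 1).is_const_of_fderivWithin_eq_zero (𝕜 := ℝ)
    (f := fun x => (∑' n, c n * x ^ n) * Real.exp (∑' n, g n * x ^ n))
    (fun x hx => (hderiv x (abs_lt.mpr hx)).differentiableAt.differentiableWithinAt)
    (fun x hx => by
      have := (hderiv x (abs_lt.mpr hx)).hasFDerivAt.hasFDerivWithinAt (s := Set.Ioo (-1) 1)
      rw [this.fderivWithin (isOpen_Ioo.uniqueDiffWithinAt hx)]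
      ext; simp)
    (show (0 : ℝ) ∈ Set.Ioo (-1) 1 by constructor <;> norm_num)
    (show r ∈ Set.Ioo (-1) 1 from ⟨by linarith, hr⟩)
  have hz : ∀ a : ℕ → ℝ, ∑' n, a n * (0 : ℝ) ^ n = a 0 := fun a => by
    rw [tsum_eq_single 0 fun n hn => by simp [hn]]; simp
  have hc0 : c 0 = 1 := by
    rw [hc]; simp [constantCoeff_atomPart_ladderSeries]
  have hg0 : g 0 = 0 := by simp [hg]
  simp only [hz, hc0, hg0, Real.exp_zero, mul_one] at hconst
  rw [Real.exp_neg, ← one_div, eq_div_iff (Real.exp_pos _).ne']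
  exact hconst.symm

theorem atom_div_nonneg (hμ : IsSymmetricStep μ) (n : ℕ) : 0 ≤ (μ ^ n).coeff 0 / n :=
  div_nonneg (coeff_pow_nonneg hμ.nonneg n 0) n.cast_nonneg

theorem summable_atom_div_mul_pow (hμ : IsSymmetricStep μ) {r : ℝ} (hr0 : 0 ≤ r) (hr : r < 1) :
    Summable fun n : ℕ => (μ ^ n).coeff 0 / n * r ^ n := by
  refine (summable_abs_mul_pow (M := 1) (fun n => ?_) (by rwa [abs_of_nonneg hr0])).of_abs
  rw [abs_of_nonneg (atom_div_nonneg hμ n)]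
  rcases n.eq_zero_or_pos with rfl | hn
  · simp
  · have hn1 : (1 : ℝ) ≤ n := by exact_mod_cast hn
    rw [div_le_one (by linarith)]
    exact (coeff_pow_le_one hμ n 0).trans hn1

/-- All coefficients of `c` beyond the constant one are nonpositive, so `c` decreases on `[0, 1]`.
-/
theorem tsum_atomPart_le (hμ : IsSymmetricStep μ) {r : ℝ} (hr0 : 0 ≤ r) (hr : r < 1) :
    ∑' n, coeff n (atomPart (ladderSeries μ)) ≤
      ∑' n, coeff n (atomPart (ladderSeries μ)) * r ^ n := by
  refine Summable.tsum_le_tsum (fun n => ?_) (summable_atomPart_ladderSeries hμ)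
    (summable_abs_mul_pow (abs_coeff_atomPart_le hμ) (by rwa [abs_of_nonneg hr0])).of_abs
  rcases n.eq_zero_or_pos with rfl | hn
  · simp
  · rw [coeff_atomPart_ladderSeries, if_neg hn.ne', zero_sub, neg_mul]
    exact neg_le_neg (mul_le_of_le_one_right (coeff_exitLaw_nonneg hμ.nonneg n 0)
      (pow_le_one₀ hr0 hr.le))

/-- For `r < 1` the partial sums of the nonnegative series are at most `-log c(r) ≤ -log c(1)`.
Letting `r → 1` bounds those at `r = 1`. The positivity of `c(1)` keeps the logarithm from
degenerating. -/
theorem summable_atom_div (hμ : IsSymmetricStep μ)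
    (hpos : 0 < ∑' n, coeff n (atomPart (ladderSeries μ))) :
    Summable fun n : ℕ => (μ ^ n).coeff 0 / n := by
  refine summable_of_sum_range_le (c := -Real.log (∑' n, coeff n (atomPart (ladderSeries μ))))
    (atom_div_nonneg hμ) fun N => ?_
  have hlim : Tendsto (fun r : ℝ => ∑ n ∈ Finset.range N, (μ ^ n).coeff 0 / n * r ^ n)
      (𝓝[<] 1) (𝓝 (∑ n ∈ Finset.range N, (μ ^ n).coeff 0 / n)) := by
    have : Continuous fun r : ℝ => ∑ n ∈ Finset.range N, (μ ^ n).coeff 0 / n * r ^ n := by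
      fun_prop
    simpa using (this.tendsto 1).mono_left nhdsWithin_le_nhds
  refine le_of_tendsto hlim ?_
  filter_upwards [Ioo_mem_nhdsLT (show (0 : ℝ) < 1 by norm_num)] with r hr
  refine ((summable_atom_div_mul_pow hμ hr.1.le hr.2).sum_le_tsum _ fun n _ =>
    mul_nonneg (atom_div_nonneg hμ n) (pow_nonneg hr.1.le n)).trans ?_
  rw [le_neg, ← Real.log_exp (-∑' n : ℕ, _), ← tsum_atomPart_mul_pow_eq_exp hμ hr.1.le hr.2]
  exact Real.log_le_log hpos (tsum_atomPart_le hμ hr.1.le hr.2)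

/-- Abel's theorem is applied on both sides of the exponential formula. -/
theorem tsum_atomPart_eq_exp (hμ : IsSymmetricStep μ)
    (hpos : 0 < ∑' n, coeff n (atomPart (ladderSeries μ))) :
    ∑' n, coeff n (atomPart (ladderSeries μ)) = Real.exp (-∑' n : ℕ, (μ ^ n).coeff 0 / n) := by
  have h1 := Real.tendsto_tsum_powerSeries_nhdsWithin_lt
    (summable_atomPart_ladderSeries hμ).hasSum.tendsto_sum_nat
  have h2 := Real.tendsto_tsum_powerSeries_nhdsWithin_lt
    (summable_atom_div hμ hpos).hasSum.tendsto_sum_nat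
  refine tendsto_nhds_unique h1 (((Real.continuous_exp.tendsto _).comp h2.neg).congr' ?_)
  filter_upwards [Ioo_mem_nhdsLT (show (0 : ℝ) < 1 by norm_num)] with r hr
  exact (tsum_atomPart_mul_pow_eq_exp hμ hr.1.le hr.2).symm

/-- The mean of the first weak descending ladder height, up to sign. -/
noncomputable def ladderMean (μ : RealGroupAlgebra) : ℝ :=
  ∑' n, pairing (fun y => y) (coeff n (ladderSeries μ))

theorem hasSum_ladderMean (hμ : IsSymmetricStep μ) :
    HasSum (fun n => -pairing (fun y => y) (exitLaw μ n)) (ladderMean μ) := by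
  have h := (summable_abs_pairing_ladderSeries hμ (f := fun y => y) continuous_id).of_abs.hasSum
  refine h.congr_fun fun n => ?_
  rw [pairing_coeff_ladderSeries]
  simp

/-- In `2m² = c(1) σ²` the left side is positive and `σ² ≥ 0`. -/
theorem atomPart_pos_of_ladderMean_pos (hμ : IsSymmetricStep μ) (h : 0 < ladderMean μ) :
    0 < ∑' n, coeff n (atomPart (ladderSeries μ)) := by
  have h2 := two_mul_sq_tsum_firstMoment_ladderSeries hμ
  have h3 : 0 ≤ pairing (fun y => y ^ 2) μ := pairing_nonneg hμ.nonneg fun y _ => sq_nonneg y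
  have h4 : 0 < 2 * ladderMean μ ^ 2 := by positivity
  exact pos_of_mul_pos_left (h4.trans_eq h2) h3

/-- Spitzer's formula for the mean ladder height of a symmetric step law. -/
theorem two_mul_ladderMean_sq (hμ : IsSymmetricStep μ) (h : 0 < ladderMean μ) :
    2 * ladderMean μ ^ 2 =
      Real.exp (-∑' n : ℕ, (μ ^ n).coeff 0 / n) * pairing (fun y => y ^ 2) μ := by
  rw [← tsum_atomPart_eq_exp hμ (atomPart_pos_of_ladderMean_pos hμ h)]
  exact two_mul_sq_tsum_firstMoment_ladderSeries hμ

theorem tendsto_aliveLaw_mass (hμ : IsSymmetricStep μ) :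
    Tendsto (fun n => pairing (fun _ => 1) (aliveLaw μ n)) atTop (𝓝 0) := by
  have h := (summable_abs_pairing_ladderSeries hμ (f := fun _ => 1)
    continuous_const).of_abs.hasSum.tendsto_sum_nat
  rw [tsum_mass_ladderSeries hμ] at h
  refine (h.comp (tendsto_add_atTop_nat 1)).congr fun n => ?_
  simp only [Function.comp_apply, pairing_coeff_ladderSeries, Finset.sum_sub_distrib,
    sum_exitLaw_mass hμ]
  simp

end RealGroupAlgebra

/-! ### Harmonic functions on the half-line -/

namespace RealGroupAlgebra
open Filter Topology

variable {μ : RealGroupAlgebra}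

/-- Harmonic functions on the half-line `(0, ∞)` with zero values outside of it and bounded
distance to the identity. -/
structure IsHalfLineSolution (μ : RealGroupAlgebra) (f : ℝ → ℝ) : Prop where
  harmonic : ∀ y, 0 < y → pairing (fun z => f (y + z)) μ = f y
  eq_zero : ∀ y ≤ 0, f y = 0
  bounded : ∃ C, ∀ y, 0 < y → |f y - y| ≤ C

open Classical in
/-- The iterates of the averaging operator killed on `(-∞, 0]`, started at `y ↦ max y 0`. -/
noncomputable def killedIterate (μ : RealGroupAlgebra) : ℕ → ℝ → ℝ
  | 0 => fun y => max y 0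
  | n + 1 => fun y => if 0 < y then pairing (fun z => killedIterate μ n (y + z)) μ else 0

theorem killedIterate_succ_of_pos (n : ℕ) {y : ℝ} (hy : 0 < y) :
    killedIterate μ (n + 1) y = pairing (fun z => killedIterate μ n (y + z)) μ := by
  simp [killedIterate, hy]

theorem killedIterate_of_nonpos (n : ℕ) {y : ℝ} (hy : y ≤ 0) : killedIterate μ n y = 0 := by
  cases n with
  | zero => simpa [killedIterate] using hy
  | succ n => simp [killedIterate, hy.not_gt]

theorem pairing_add_const (hμ : IsSymmetricStep μ) (y : ℝ) :
    pairing (fun z => y + z) μ = y := by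
  rw [pairing_fun_add, pairing_const, hμ.mass, hμ.firstMoment]
  ring

/-- Steps have mean zero, so `max y 0` is subharmonic for the killed walk; monotonicity of averaging
propagates the first inequality. -/
theorem killedIterate_le_succ (hμ : IsSymmetricStep μ) (n : ℕ) :
    ∀ y, killedIterate μ n y ≤ killedIterate μ (n + 1) y := by
  induction n with
  | zero =>
    intro y
    rcases le_or_gt y 0 with hy | hy
    · rw [killedIterate_of_nonpos 0 hy, killedIterate_of_nonpos 1 hy]
    · rw [killedIterate_succ_of_pos 0 hy]
      calc killedIterate μ 0 y = pairing (fun z => y + z) μ := by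
            rw [pairing_add_const hμ]; simp [killedIterate, hy.le]
        _ ≤ _ := pairing_mono hμ.nonneg fun z _ => le_max_left _ _
  | succ n ih =>
    intro y
    rcases le_or_gt y 0 with hy | hy
    · rw [killedIterate_of_nonpos _ hy, killedIterate_of_nonpos _ hy]
    · rw [killedIterate_succ_of_pos _ hy, killedIterate_succ_of_pos _ hy]
      exact pairing_mono hμ.nonneg fun z _ => ih _

/-- The function `y + m` is harmonic, and it is nonnegative at every point reachable in one step
from `(0, ∞)`, so it serves as an upper barrier. -/
theorem killedIterate_le (hμ : IsSymmetricStep μ) {m : ℝ} (hm0 : 0 ≤ m)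
    (hm : ∀ y, m < |y| → μ.coeff y = 0) (n : ℕ) : ∀ y, killedIterate μ n y ≤ max (y + m) 0 := by
  induction n with
  | zero => exact fun y => max_le_max_right 0 (by linarith)
  | succ n ih =>
    intro y
    rcases le_or_gt y 0 with hy | hy
    · rw [killedIterate_of_nonpos _ hy]; exact le_max_right _ _
    · rw [killedIterate_succ_of_pos _ hy]
      calc _ ≤ pairing (fun z => (y + m) + z) μ := pairing_mono hμ.nonneg fun z hz => by
            refine (ih _).trans (max_le (by linarith) ?_)
            have := neg_abs_le z
            have : |z| ≤ m := not_lt.mp fun h => hz (hm z h)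
            linarith
        _ = y + m := pairing_add_const hμ _
        _ ≤ _ := le_max_left _ _

/-- The solution is the monotone limit of the killed iterates, squeezed between `y` and `y + m`. The
lower bound is kept because it gives positivity of the ladder mean. -/
theorem exists_isHalfLineSolution (hμ : IsSymmetricStep μ) :
    ∃ f, IsHalfLineSolution μ f ∧ ∀ y, 0 < y → y ≤ f y := by
  obtain ⟨m, hm0, hm⟩ := exists_support_bound μ
  have hbdd : ∀ y, BddAbove (Set.range fun n => killedIterate μ n y) := fun y =>
    ⟨_, by rintro _ ⟨n, rfl⟩; exact killedIterate_le hμ hm0 hm n y⟩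
  have hlim : ∀ y, Tendsto (fun n => killedIterate μ n y) atTop (𝓝 (⨆ n, killedIterate μ n y)) :=
    fun y => tendsto_atTop_ciSup (monotone_nat_of_le_succ fun n => killedIterate_le_succ hμ n y)
      (hbdd y)
  have hlow : ∀ y, 0 < y → y ≤ ⨆ n, killedIterate μ n y := fun y _ =>
    (le_max_left y 0).trans (le_ciSup (hbdd y) 0)
  refine ⟨fun y => ⨆ n, killedIterate μ n y, ⟨fun y hy => ?_, fun y hy => ?_, m, fun y hy => ?_⟩,
    hlow⟩
  · refine tendsto_nhds_unique ?_ ((hlim y).comp (tendsto_add_atTop_nat 1))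
    have : Tendsto (fun n => pairing (fun z => killedIterate μ n (y + z)) μ) atTop
        (𝓝 (pairing (fun z => ⨆ n, killedIterate μ n (y + z)) μ)) :=
      tendsto_finsetSum _ fun z _ => (hlim (y + z)).const_mul _
    exact this.congr fun n => (killedIterate_succ_of_pos n hy).symm
  · simp [killedIterate_of_nonpos _ hy]
  · have h : ⨆ n, killedIterate μ n y ≤ y + m := ciSup_le fun n =>
      (killedIterate_le hμ hm0 hm n y).trans (max_le le_rfl (by linarith))
    rw [abs_le]
    constructor <;> linarith [hlow y hy]

theorem pairing_restrict_Iic_eq_zero {f : ℝ → ℝ} (hf : ∀ y ≤ 0, f y = 0) (a : RealGroupAlgebra) :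
    pairing f (restrict (Set.Iic 0) a) = 0 := by
  rw [pairing_congr (g := fun _ => 0), pairing_const, zero_mul]
  exact fun y hy => hf y (not_lt.mp fun h => hy (coeff_restrict_of_notMem a (by simpa using h)))

/-- Optional stopping: `f` vanishes at the exit position and is harmonic where the walk is alive.
The comparison starts at time `1`, because `f` need not be harmonic at the starting point `0`. -/
theorem IsHalfLineSolution.pairing_aliveLaw {f : ℝ → ℝ} (hf : IsHalfLineSolution μ f) (n : ℕ) :
    pairing f (aliveLaw μ (n + 1)) = pairing f μ := by
  have hstep : ∀ n, pairing f (aliveLaw μ (n + 1)) =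
      pairing (fun y => pairing (fun z => f (y + z)) μ) (aliveLaw μ n) := fun n => by
    rw [← pairing_mul, ← aliveLaw_succ_add_exitLaw_succ, map_add]
    exact (add_eq_left.mpr (pairing_restrict_Iic_eq_zero hf.eq_zero _)).symm
  induction n with
  | zero => rw [hstep, aliveLaw, pairing_one]; simp
  | succ n ih =>
    rw [hstep, ← ih]
    exact pairing_congr fun y hy => hf.harmonic y
      (not_le.mp fun h => hy (coeff_aliveLaw_succ_of_nonpos μ n h))

theorem firstMoment_aliveLaw (hμ : IsSymmetricStep μ) (n : ℕ) :
    pairing (fun y => y) (aliveLaw μ n) =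
      ∑ k ∈ Finset.range (n + 1), -pairing (fun y => y) (exitLaw μ k) := by
  induction n with
  | zero => simp [exitLaw, aliveLaw]
  | succ n ih =>
    have h := congrArg (pairing fun y => y) (aliveLaw_succ_add_exitLaw_succ μ n)
    rw [map_add, firstMoment_mul, hμ.mass, hμ.firstMoment] at h
    rw [Finset.sum_range_succ, ← ih]
    linarith

/-- On the surviving walk `f` differs from the identity by at most `C`, and the surviving mass tends
to `0`. So the conserved integral of `f` is the limit of the first moments of the alive laws. Those
are the partial sums of the ladder mean, since the walk has no drift. -/
theorem IsHalfLineSolution.pairing_eq_ladderMean {f : ℝ → ℝ} (hμ : IsSymmetricStep μ)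
    (hf : IsHalfLineSolution μ f) : pairing f μ = ladderMean μ := by
  obtain ⟨C, hC⟩ := hf.bounded
  have h1 : Tendsto (fun n => pairing (fun y => y) (aliveLaw μ (n + 1))) atTop
      (𝓝 (ladderMean μ)) := by
    simp_rw [firstMoment_aliveLaw hμ]
    exact (hasSum_ladderMean hμ).tendsto_sum_nat.comp (tendsto_add_atTop_nat 2)
  have h2 : Tendsto (fun n => pairing f μ - pairing (fun y => y) (aliveLaw μ (n + 1))) atTop
      (𝓝 0) := by
    refine squeeze_zero_norm (fun n => ?_)
      (by simpa using ((tendsto_aliveLaw_mass hμ).comp (tendsto_add_atTop_nat 1)).const_mul C)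
    have hsupp : ∀ y, (aliveLaw μ (n + 1)).coeff y ≠ 0 → 0 < y := fun y hy =>
      not_le.mp fun h => hy (coeff_aliveLaw_succ_of_nonpos μ n h)
    have hnn := coeff_aliveLaw_nonneg hμ.nonneg (n + 1)
    rw [Real.norm_eq_abs, ← hf.pairing_aliveLaw n, abs_le, ← pairing_const]
    have hle := pairing_mono (f := f) (g := fun y => y + C) hnn fun y hy => by
      linarith [(abs_le.mp (hC y (hsupp y hy))).2]
    have hge := pairing_mono (f := fun y => y) (g := fun y => f y + C) hnn fun y hy => by
      linarith [(abs_le.mp (hC y (hsupp y hy))).1]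
    rw [pairing_fun_add] at hle hge
    constructor <;> linarith
  have h3 := h1.add h2
  simp only [add_zero, add_sub_cancel] at h3
  exact tendsto_nhds_unique tendsto_const_nhds h3

theorem ladderMean_pos (hμ : IsSymmetricStep μ) {z : ℝ} (hz : 0 < z) (hμz : μ.coeff z ≠ 0) :
    0 < ladderMean μ := by
  obtain ⟨f, hf, hfle⟩ := exists_isHalfLineSolution hμ
  have hnn : ∀ y, 0 ≤ f y := fun y => by
    rcases le_or_gt y 0 with h | h
    · exact (hf.eq_zero y h).ge
    · exact h.le.trans (hfle y h)
  rw [← hf.pairing_eq_ladderMean hμ]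
  have hpos : 0 < μ.coeff z := lt_of_le_of_ne (hμ.nonneg z) hμz.symm
  exact (mul_pos hpos (hz.trans_le (hfle z hz))).trans_le
    (Finset.single_le_sum (f := fun y => μ.coeff y * f y)
      (fun y _ => mul_nonneg (hμ.nonneg y) (hnn y)) (Finsupp.mem_support_iff.mpr hμz))

end RealGroupAlgebra

/-! ### The half-space problem on `ℤ^d` and the projected walk -/

section Lattice

variable {d : ℕ}

theorem latticeDot_add (p : EuclideanSpace ℝ (Fin d)) (x y : Fin d → ℤ) :
    latticeDot p (x + y) = latticeDot p x + latticeDot p y := by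
  simp [latticeDot, mul_add, Finset.sum_add_distrib]

theorem latticeDot_zero (p : EuclideanSpace ℝ (Fin d)) : latticeDot p 0 = 0 := by
  simp [latticeDot]

/-- The map `x ↦ p · x` as a homomorphism. -/
noncomputable def latticeDotHom (p : EuclideanSpace ℝ (Fin d)) : (Fin d → ℤ) →+ ℝ where
  toFun := latticeDot p
  map_zero' := latticeDot_zero p
  map_add' := latticeDot_add p

theorem latticeDotHom_apply (p : EuclideanSpace ℝ (Fin d)) (x : Fin d → ℤ) :
    latticeDotHom p x = latticeDot p x := rfl

theorem latticeDot_single (p : EuclideanSpace ℝ (Fin d)) (i : Fin d) :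
    latticeDot p (Pi.single i 1) = p i := by
  simp [latticeDot, Pi.single_apply]

theorem latticeDot_add_single (p : EuclideanSpace ℝ (Fin d)) (x : Fin d → ℤ) (i : Fin d) :
    latticeDot p (x + Pi.single i 1) = latticeDot p x + p i := by
  rw [latticeDot_add, latticeDot_single]

theorem latticeDot_sub_single (p : EuclideanSpace ℝ (Fin d)) (x : Fin d → ℤ) (i : Fin d) :
    latticeDot p (x - Pi.single i 1) = latticeDot p x - p i := by
  rw [← latticeDotHom_apply, map_sub, latticeDotHom_apply, latticeDotHom_apply, latticeDot_single]

theorem latticeLaplacian_comp_latticeDot (p : EuclideanSpace ℝ (Fin d)) (φ : ℝ → ℝ)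
    (x : Fin d → ℤ) :
    latticeLaplacian (fun x => φ (latticeDot p x)) x =
      ∑ i, (φ (latticeDot p x + p i) + φ (latticeDot p x - p i) - 2 * φ (latticeDot p x)) := by
  simp only [latticeLaplacian, latticeDot_add_single, latticeDot_sub_single]

theorem latticeLaplacian_sub (u v : (Fin d → ℤ) → ℝ) (x : Fin d → ℤ) :
    latticeLaplacian (fun x => u x - v x) x = latticeLaplacian u x - latticeLaplacian v x := by
  simp only [latticeLaplacian, ← Finset.sum_sub_distrib]
  exact Finset.sum_congr rfl fun i _ => by ring

theorem latticeLaplacian_le {D : (Fin d → ℤ) → ℝ} {x : Fin d → ℤ} {M : ℝ}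
    (h1 : ∀ i, D (x + Pi.single i 1) ≤ M) (h2 : ∀ i, D (x - Pi.single i 1) ≤ M) :
    latticeLaplacian D x ≤ 2 * d * (M - D x) := by
  calc latticeLaplacian D x ≤ ∑ _i : Fin d, 2 * (M - D x) :=
        Finset.sum_le_sum fun i _ => by linarith [h1 i, h2 i]
    _ = 2 * d * (M - D x) := by simp; ring

theorem exists_coord_ne_zero {p : EuclideanSpace ℝ (Fin d)} (hp : p ≠ 0) : ∃ i, p i ≠ 0 := by
  by_contra! h
  exact hp (by ext i; simpa using h i)

theorem dim_pos {p : EuclideanSpace ℝ (Fin d)} (hp : p ≠ 0) : 0 < d := by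
  obtain ⟨i, _⟩ := exists_coord_ne_zero hp
  exact i.pos

/-- A maximum principle in a strip `0 < p · x ≤ R`, for functions that are bounded above and
uniformly strictly subharmonic there. -/
theorem nonpos_of_strictly_subharmonic_on_strip {p : EuclideanSpace ℝ (Fin d)} (hp : p ≠ 0)
    {D : (Fin d → ℤ) → ℝ} {R K κ : ℝ} (hκ : 0 < κ)
    (hlap : ∀ x, 0 < latticeDot p x → latticeDot p x ≤ R → κ ≤ latticeLaplacian D x)
    (hleft : ∀ x, -‖p‖ ≤ latticeDot p x → latticeDot p x ≤ 0 → D x ≤ 0)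
    (hright : ∀ x, R < latticeDot p x → latticeDot p x ≤ R + ‖p‖ → D x ≤ 0)
    (hbdd : ∀ x, 0 < latticeDot p x → latticeDot p x ≤ R → D x ≤ K)
    (x : Fin d → ℤ) (hx0 : 0 < latticeDot p x) (hxR : latticeDot p x ≤ R) : D x ≤ 0 := by
  by_contra! hpos
  set S := D '' {x | 0 < latticeDot p x ∧ latticeDot p x ≤ R} with hS
  have hSb : BddAbove S := ⟨K, by rintro _ ⟨y, hy, rfl⟩; exact hbdd y hy.1 hy.2⟩
  have hxS : D x ∈ S := ⟨x, ⟨hx0, hxR⟩, rfl⟩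
  have hM : D x ≤ sSup S := le_csSup hSb hxS
  have hd : (0 : ℝ) < d := by exact_mod_cast dim_pos hp
  -- The strip may be infinite and the supremum not attained, so `y` is a near-maximizer. All its
  -- neighbours have values at most the supremum, hence the Laplacian at `y` is at most `2d` times
  -- the gap. A gap below `κ / (2d)` contradicts the lower bound `κ`.
  obtain ⟨_, ⟨y, ⟨hy0, hyR⟩, rfl⟩, hy⟩ := exists_lt_of_lt_csSup ⟨_, hxS⟩
    (show sSup S - κ / (2 * d) < sSup S by have : 0 < κ / (2 * d) := by positivity
                                           linarith)
  have hle : ∀ z, latticeDot p y - ‖p‖ ≤ latticeDot p z → latticeDot p z ≤ latticeDot p y + ‖p‖ →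
      D z ≤ sSup S := fun z h1 h2 => by
    rcases le_or_gt (latticeDot p z) 0 with hz | hz
    · exact (hleft z (by linarith) hz).trans (hpos.le.trans hM)
    · rcases le_or_gt (latticeDot p z) R with hz' | hz'
      · exact le_csSup hSb ⟨z, ⟨hz, hz'⟩, rfl⟩
      · exact (hright z hz' (by linarith)).trans (hpos.le.trans hM)
  have hcoord : ∀ i, |p i| ≤ ‖p‖ := fun i => PiLp.norm_apply_le p i
  have h := latticeLaplacian_le (D := D) (x := y) (M := sSup S)
    (fun i => hle _ (by rw [latticeDot_add_single]; linarith [(abs_le.mp (hcoord i)).1])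
      (by rw [latticeDot_add_single]; linarith [(abs_le.mp (hcoord i)).2]))
    (fun i => hle _ (by rw [latticeDot_sub_single]; linarith [(abs_le.mp (hcoord i)).2])
      (by rw [latticeDot_sub_single]; linarith [(abs_le.mp (hcoord i)).1]))
  have h2 := hlap y hy0 hyR
  have h3 : 2 * d * (sSup S - D y) < 2 * d * (κ / (2 * d)) :=
    mul_lt_mul_of_pos_left (by linarith) (by positivity)
  rw [mul_div_cancel₀ _ (by positivity)] at h3
  linarith

theorem sum_sq_coord (p : EuclideanSpace ℝ (Fin d)) : ∑ i, p i ^ 2 = ‖p‖ ^ 2 :=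
  (EuclideanSpace.real_norm_sq_eq p).symm

/-- A Phragmén–Lindelöf principle: bounded harmonic functions on a half-space are controlled by
their boundary values. -/
theorem nonpos_of_harmonic_of_bddAbove {p : EuclideanSpace ℝ (Fin d)} (hp : p ≠ 0)
    {w : (Fin d → ℤ) → ℝ} {C : ℝ} (hharm : ∀ x, 0 < latticeDot p x → latticeLaplacian w x = 0)
    (hzero : ∀ x, latticeDot p x ≤ 0 → w x ≤ 0) (hC : ∀ x, 0 < latticeDot p x → w x ≤ C)
    (x : Fin d → ℤ) : w x ≤ 0 := by
  rcases le_or_gt (latticeDot p x) 0 with hx | hx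
  · exact hzero x hx
  by_contra! hw
  have hm : 0 < ‖p‖ := norm_pos_iff.mpr hp
  set y := latticeDot p x with hy
  -- The barrier `h` is a linear part plus a concave part, each worth at most `w x / 3` at `y`. The
  -- level `R` is at least `y`, and large enough that the linear part exceeds `C` beyond it.
  set ε := w x / (3 * (y + ‖p‖)) with hε
  have hε0 : 0 < ε := by positivity
  set R := max (C / ε) y with hR
  have hR0 : 0 < R := hx.trans_le (le_max_right _ _)
  set η := w x / (3 * (R + ‖p‖) ^ 2) with hη
  have hη0 : 0 < η := by positivity
  set h : ℝ → ℝ := fun t => ε * (t + ‖p‖) + η * ((R + ‖p‖) ^ 2 - t ^ 2) with hh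
  have hnn : ∀ t, -‖p‖ ≤ t → t ≤ R + ‖p‖ → ε * (t + ‖p‖) ≤ h t := fun t h1 h2 => by
    have : t ^ 2 ≤ (R + ‖p‖) ^ 2 := sq_le_sq' (by linarith) h2
    have := mul_nonneg hη0.le (sub_nonneg.mpr this)
    simp only [hh]; linarith
  -- The term `-η t²` has Laplacian `-2η‖p‖²`, which makes `w - h` strictly subharmonic. The
  -- conclusion `w x ≤ h y ≤ 2 w x / 3` is absurd.
  have key := nonpos_of_strictly_subharmonic_on_strip hp (D := fun x => w x - h (latticeDot p x))
    (R := R) (K := C) (κ := 2 * η * ‖p‖ ^ 2) (by positivity)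
    (fun z hz _ => by
      rw [latticeLaplacian_sub, hharm z hz, latticeLaplacian_comp_latticeDot, ← sum_sq_coord,
        Finset.mul_sum, zero_sub, ← Finset.sum_neg_distrib]
      refine (Finset.sum_congr rfl fun i _ => ?_).le
      simp only [hh]; ring)
    (fun z h1 h2 => by
      have h3 := hnn _ h1 (by linarith)
      have h4 : 0 ≤ ε * (latticeDot p z + ‖p‖) := mul_nonneg hε0.le (by linarith)
      linarith [hzero z h2])
    (fun z h1 h2 => by
      have h3 := hnn _ (by linarith) h2
      have h4 : C ≤ ε * (latticeDot p z + ‖p‖) := by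
        rw [mul_comm, ← div_le_iff₀ hε0]
        linarith [le_max_left (C / ε) y]
      linarith [hC z (by linarith)])
    (fun z h1 h2 => by
      have h3 := hnn _ (by linarith) (by linarith)
      have h4 : 0 ≤ ε * (latticeDot p z + ‖p‖) := mul_nonneg hε0.le (by linarith)
      linarith [hC z h1])
    x hx (le_max_right _ _)
  have e1 : ε * (y + ‖p‖) = w x / 3 := by rw [hε]; field_simp
  have e2 : η * ((R + ‖p‖) ^ 2 - y ^ 2) ≤ w x / 3 := by
    have : η * (R + ‖p‖) ^ 2 = w x / 3 := by rw [hη]; field_simp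
    have h5 : 0 ≤ η * y ^ 2 := by positivity
    linarith
  simp only [hh, ← hy, e1] at key
  linarith

theorem IsHalfSpaceSolution.le {p : EuclideanSpace ℝ (Fin d)} (hp : p ≠ 0)
    {u v : (Fin d → ℤ) → ℝ} (hu : IsHalfSpaceSolution p u) (hv : IsHalfSpaceSolution p v)
    (x : Fin d → ℤ) : u x ≤ v x := by
  obtain ⟨C, hC⟩ := hu.bounded
  obtain ⟨C', hC'⟩ := hv.bounded
  have h := nonpos_of_harmonic_of_bddAbove hp (w := fun x => u x - v x) (C := C + C')
    (fun x hx => by rw [latticeLaplacian_sub, hu.harmonic x hx, hv.harmonic x hx, sub_self])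
    (fun x hx => by rw [hu.eq_zero x hx, hv.eq_zero x hx, sub_self])
    (fun x hx => by linarith [(abs_le.mp (hC x hx)).2, (abs_le.mp (hC' x hx)).1]) x
  linarith

theorem IsHalfSpaceSolution.unique {p : EuclideanSpace ℝ (Fin d)} (hp : p ≠ 0)
    {u v : (Fin d → ℤ) → ℝ} (hu : IsHalfSpaceSolution p u) (hv : IsHalfSpaceSolution p v) :
    u = v :=
  funext fun x => le_antisymm (hu.le hp hv x) (hv.le hp hu x)

/-- The step law of the simple random walk on `ℤ^d`. -/
noncomputable def latticeStep (d : ℕ) : AddMonoidAlgebra ℝ (Fin d → ℤ) :=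
  ∑ i, (AddMonoidAlgebra.single (Pi.single i 1) (1 / (2 * d : ℝ)) +
    AddMonoidAlgebra.single (-Pi.single i 1) (1 / (2 * d : ℝ)))

/-- The step law of the projection of the simple random walk along `p`. -/
noncomputable def projectedStep (p : EuclideanSpace ℝ (Fin d)) : RealGroupAlgebra :=
  AddMonoidAlgebra.mapDomainRingHom ℝ (latticeDotHom p) (latticeStep d)

open RealGroupAlgebra

theorem projectedStep_eq (p : EuclideanSpace ℝ (Fin d)) :
    projectedStep p = ∑ i, (AddMonoidAlgebra.single (p i) (1 / (2 * d : ℝ)) +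
      AddMonoidAlgebra.single (-p i) (1 / (2 * d : ℝ))) := by
  simp only [projectedStep, latticeStep, map_sum, map_add,
    AddMonoidAlgebra.mapDomainRingHom_apply, AddMonoidAlgebra.mapDomain_single]
  simp only [map_neg, latticeDotHom_apply, latticeDot_single]

theorem pairing_projectedStep (p : EuclideanSpace ℝ (Fin d)) (f : ℝ → ℝ) :
    pairing f (projectedStep p) = 1 / (2 * d) * ∑ i, (f (p i) + f (-p i)) := by
  rw [projectedStep_eq, map_sum, Finset.mul_sum]
  exact Finset.sum_congr rfl fun i _ => by rw [map_add, pairing_single, pairing_single]; ring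

theorem coeff_projectedStep (p : EuclideanSpace ℝ (Fin d)) (y : ℝ) :
    (projectedStep p).coeff y =
      ∑ i, ((if p i = y then 1 / (2 * d : ℝ) else 0) + if -p i = y then 1 / (2 * d : ℝ) else 0) := by
  rw [projectedStep_eq, AddMonoidAlgebra.coeff_sum, Finsupp.finsetSum_apply]
  refine Finset.sum_congr rfl fun i _ => ?_
  rw [AddMonoidAlgebra.coeff_add, Finsupp.add_apply, AddMonoidAlgebra.coeff_single,
    AddMonoidAlgebra.coeff_single, Finsupp.single_apply, Finsupp.single_apply]

theorem isSymmetricStep_projectedStep {p : EuclideanSpace ℝ (Fin d)} (hp : p ≠ 0) :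
    IsSymmetricStep (projectedStep p) where
  nonneg y := by
    rw [coeff_projectedStep]
    refine Finset.sum_nonneg fun i _ => ?_
    split_ifs <;> positivity
  mass := by
    have hd : (d : ℝ) ≠ 0 := by exact_mod_cast (dim_pos hp).ne'
    rw [pairing_projectedStep]
    simp
    field_simp
    norm_num
  reflect_eq := by
    simp only [projectedStep_eq, map_sum, map_add, reflect_single, neg_neg]
    exact Finset.sum_congr rfl fun i _ => add_comm _ _

theorem secondMoment_projectedStep (p : EuclideanSpace ℝ (Fin d)) :
    pairing (fun y => y ^ 2) (projectedStep p) = ‖p‖ ^ 2 / d := by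
  rw [pairing_projectedStep, ← sum_sq_coord]
  simp only [neg_sq, ← two_mul, ← Finset.mul_sum]
  rw [one_div, mul_inv, div_eq_mul_inv]
  ring

theorem exists_pos_coeff_projectedStep {p : EuclideanSpace ℝ (Fin d)} (hp : p ≠ 0) :
    ∃ z, 0 < z ∧ (projectedStep p).coeff z ≠ 0 := by
  obtain ⟨i, hi⟩ := exists_coord_ne_zero hp
  have hd : (0 : ℝ) < d := by exact_mod_cast dim_pos hp
  refine ⟨|p i|, abs_pos.mpr hi, ne_of_gt ?_⟩
  rw [coeff_projectedStep]
  refine Finset.sum_pos' (fun j _ => by split_ifs <;> positivity) ⟨i, Finset.mem_univ i, ?_⟩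
  rcases abs_choice (p i) with h | h <;> rw [h]
  · rw [if_pos rfl]; split_ifs <;> positivity
  · rw [if_pos (rfl : -p i = -p i)]; split_ifs <;> positivity

theorem two_mul_dim_mul_pairing {p : EuclideanSpace ℝ (Fin d)} (hp : p ≠ 0) (f : ℝ → ℝ) (y : ℝ) :
    ∑ i, (f (y + p i) + f (y - p i) - 2 * f y) =
      2 * d * (pairing (fun z => f (y + z)) (projectedStep p) - f y) := by
  have hd : (d : ℝ) ≠ 0 := by exact_mod_cast (dim_pos hp).ne'
  rw [pairing_projectedStep, Finset.sum_sub_distrib]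
  simp only [Finset.sum_const, Finset.card_univ, Fintype.card_fin, nsmul_eq_mul, ← sub_eq_add_neg]
  field_simp

theorem RealGroupAlgebra.IsHalfLineSolution.isHalfSpaceSolution {p : EuclideanSpace ℝ (Fin d)}
    (hp : p ≠ 0) {f : ℝ → ℝ} (hf : IsHalfLineSolution (projectedStep p) f) :
    IsHalfSpaceSolution p fun x => f (latticeDot p x) where
  harmonic x hx := by
    rw [latticeLaplacian_comp_latticeDot, two_mul_dim_mul_pairing hp, hf.harmonic _ hx, sub_self,
      mul_zero]
  eq_zero x hx := hf.eq_zero _ hx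
  bounded := hf.bounded.imp fun _ hC x hx => hC _ hx

theorem existsUnique_isHalfSpaceSolution {p : EuclideanSpace ℝ (Fin d)} (hp : p ≠ 0) :
    ∃! u : (Fin d → ℤ) → ℝ, IsHalfSpaceSolution p u := by
  obtain ⟨f, hf, -⟩ := exists_isHalfLineSolution (isSymmetricStep_projectedStep hp)
  exact ⟨_, hf.isHalfSpaceSolution hp, fun v hv => hv.unique hp (hf.isHalfSpaceSolution hp)⟩

theorem hamiltonian_eq_ladderMean {p : EuclideanSpace ℝ (Fin d)} (hp : p ≠ 0) :
    hamiltonian p = 2 * d * ladderMean (projectedStep p) := by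
  obtain ⟨f, hf, -⟩ := exists_isHalfLineSolution (isSymmetricStep_projectedStep hp)
  have hu := hf.isHalfSpaceSolution hp
  have he : Classical.epsilon (IsHalfSpaceSolution p) = fun x => f (latticeDot p x) :=
    (Classical.epsilon_spec ⟨_, hu⟩).unique hp hu
  rw [hamiltonian, he, latticeLaplacian_comp_latticeDot, two_mul_dim_mul_pairing hp,
    latticeDot_zero, hf.eq_zero 0 le_rfl, sub_zero,
    ← hf.pairing_eq_ladderMean (isSymmetricStep_projectedStep hp)]
  simp

theorem ladderMean_projectedStep_pos {p : EuclideanSpace ℝ (Fin d)} (hp : p ≠ 0) :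
    0 < ladderMean (projectedStep p) := by
  obtain ⟨z, hz, hz'⟩ := exists_pos_coeff_projectedStep hp
  exact ladderMean_pos (isSymmetricStep_projectedStep hp) hz hz'

theorem summable_projectedStep_atom_div {p : EuclideanSpace ℝ (Fin d)} (hp : p ≠ 0) :
    Summable fun n : ℕ => (projectedStep p ^ n).coeff 0 / n :=
  summable_atom_div (isSymmetricStep_projectedStep hp)
    (atomPart_pos_of_ladderMean_pos (isSymmetricStep_projectedStep hp)
      (ladderMean_projectedStep_pos hp))

theorem hamiltonian_sq {p : EuclideanSpace ℝ (Fin d)} (hp : p ≠ 0) :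
    hamiltonian p ^ 2 =
      2 * d * Real.exp (-∑' n : ℕ, (projectedStep p ^ n).coeff 0 / n) * ‖p‖ ^ 2 := by
  have hd : (d : ℝ) ≠ 0 := by exact_mod_cast (dim_pos hp).ne'
  have h := two_mul_ladderMean_sq (isSymmetricStep_projectedStep hp)
    (ladderMean_projectedStep_pos hp)
  rw [secondMoment_projectedStep] at h
  rw [hamiltonian_eq_ladderMean hp]
  calc (2 * d * ladderMean (projectedStep p)) ^ 2
      = 2 * d ^ 2 * (2 * ladderMean (projectedStep p) ^ 2) := by ring
    _ = _ := by rw [h]; field_simp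

end Lattice

/-! ### Fourier coefficients of `log (1 - r φ)` for `r < 1` -/

section Fourier
open Filter Topology

variable {d : ℕ}

/-- The characters `θ ↦ exp (i q · θ)` of the torus, as a homomorphism in `q`. -/
noncomputable def torusCharacter (θ : Fin d → ℝ) : Multiplicative (Fin d → ℤ) →* ℂ where
  toFun q := Complex.exp (Complex.I * ((∑ i, (q.toAdd i : ℝ) * θ i : ℝ) : ℂ))
  map_one' := by simp
  map_mul' q r := by
    rw [← Complex.exp_add, ← mul_add, ← Complex.ofReal_add, ← Finset.sum_add_distrib]
    simp [add_mul]

/-- The trigonometric polynomial with given coefficients, evaluated at `θ`. -/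
noncomputable def trigPolynomial (θ : Fin d → ℝ) : AddMonoidAlgebra ℝ (Fin d → ℤ) →ₐ[ℝ] ℂ :=
  AddMonoidAlgebra.lift ℝ ℂ (Fin d → ℤ) (torusCharacter θ)

theorem trigPolynomial_single (θ : Fin d → ℝ) (q : Fin d → ℤ) (r : ℝ) :
    trigPolynomial θ (AddMonoidAlgebra.single q r) =
      r * Complex.exp (Complex.I * ((∑ i, (q i : ℝ) * θ i : ℝ) : ℂ)) := by
  rw [trigPolynomial, AddMonoidAlgebra.lift_single, Complex.real_smul]
  rfl

theorem continuous_trigPolynomial (a : AddMonoidAlgebra ℝ (Fin d → ℤ)) :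
    Continuous fun θ : Fin d → ℝ => trigPolynomial θ a := by
  induction a using AddMonoidAlgebra.induction_linear with
  | zero => simpa using continuous_const
  | add a b ha hb => simp only [map_add]; exact ha.add hb
  | single q r =>
    simp only [trigPolynomial_single]
    fun_prop

theorem continuous_torusPhase (q : Fin d → ℤ) :
    Continuous fun θ : Fin d → ℝ =>
      Complex.exp (-(Complex.I * ((∑ i, (q i : ℝ) * θ i : ℝ) : ℂ))) := by
  fun_prop

theorem norm_torusPhase (q : Fin d → ℤ) (θ : Fin d → ℝ) :
    ‖Complex.exp (-(Complex.I * ((∑ i, (q i : ℝ) * θ i : ℝ) : ℂ)))‖ = 1 := by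
  rw [← mul_neg, ← Complex.ofReal_neg, mul_comm]
  exact Complex.norm_exp_ofReal_mul_I _

theorem isCompact_periodCell (d : ℕ) : IsCompact (periodCell d) := isCompact_Icc

theorem volume_periodCell (d : ℕ) : volume.real (periodCell d) = (2 * Real.pi) ^ d := by
  rw [Measure.real, periodCell, Real.volume_Icc_pi_toReal (fun _ => by linarith [Real.pi_pos])]
  simp [two_mul]

theorem integral_exp_int_mul_I (k : ℤ) :
    ∫ t in Set.Icc (-Real.pi) Real.pi, Complex.exp (Complex.I * (((k : ℝ) * t : ℝ) : ℂ)) =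
      if k = 0 then ((2 * Real.pi : ℝ) : ℂ) else 0 := by
  split_ifs with hk
  · subst hk
    simp [Real.pi_pos.le, two_mul]
  · rw [integral_Icc_eq_integral_Ioc, ← intervalIntegral.integral_of_le (by linarith [Real.pi_pos])]
    have hc : Complex.I * (k : ℂ) ≠ 0 := mul_ne_zero Complex.I_ne_zero (by exact_mod_cast hk)
    have h := integral_exp_mul_complex (a := -Real.pi) (b := Real.pi) hc
    have he : Complex.exp (Complex.I * k * (Real.pi : ℝ)) =
        Complex.exp (Complex.I * k * ((-Real.pi : ℝ) : ℂ)) :=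
      Complex.exp_eq_exp_iff_exists_int.mpr ⟨k, by push_cast; ring⟩
    rw [he, sub_self, zero_div] at h
    rw [← h]
    refine intervalIntegral.integral_congr fun t _ => ?_
    push_cast
    rw [mul_assoc]

theorem integral_periodCell_exp (q : Fin d → ℤ) :
    ∫ θ in periodCell d, Complex.exp (Complex.I * ((∑ i, (q i : ℝ) * θ i : ℝ) : ℂ)) =
      if q = 0 then (((2 * Real.pi) ^ d : ℝ) : ℂ) else 0 := by
  have h1 : ∀ θ : Fin d → ℝ, Complex.exp (Complex.I * ((∑ i, (q i : ℝ) * θ i : ℝ) : ℂ)) =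
      ∏ i, Complex.exp (Complex.I * (((q i : ℝ) * θ i : ℝ) : ℂ)) := fun θ => by
    rw [← Complex.exp_sum, ← Finset.mul_sum, Complex.ofReal_sum]
  simp_rw [h1]
  rw [periodCell, ← Set.pi_univ_Icc, volume_pi, Measure.restrict_pi_pi,
    integral_fintype_prod_eq_prod
      (fun i t => Complex.exp (Complex.I * (((q i : ℝ) * t : ℝ) : ℂ)))]
  simp_rw [integral_exp_int_mul_I]
  split_ifs with hq
  · subst hq; simp
  · obtain ⟨i, hi⟩ := Function.ne_iff.mp hq
    exact Finset.prod_eq_zero (Finset.mem_univ i) (if_neg hi)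

theorem integrableOn_trigPolynomial_mul_phase (a : AddMonoidAlgebra ℝ (Fin d → ℤ))
    (q : Fin d → ℤ) :
    IntegrableOn (fun θ => trigPolynomial θ a *
      Complex.exp (-(Complex.I * ((∑ i, (q i : ℝ) * θ i : ℝ) : ℂ)))) (periodCell d) :=
  ((continuous_trigPolynomial a).mul (continuous_torusPhase q)).continuousOn.integrableOn_compact
    (isCompact_periodCell d)

theorem integral_trigPolynomial_mul_phase (a : AddMonoidAlgebra ℝ (Fin d → ℤ)) (q : Fin d → ℤ) :
    ∫ θ in periodCell d, trigPolynomial θ a *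
      Complex.exp (-(Complex.I * ((∑ i, (q i : ℝ) * θ i : ℝ) : ℂ))) =
    (((2 * Real.pi) ^ d : ℝ) : ℂ) * (a.coeff q : ℂ) := by
  induction a using AddMonoidAlgebra.induction_linear with
  | zero => simp
  | add a b ha hb =>
    simp_rw [map_add, add_mul]
    rw [integral_add (integrableOn_trigPolynomial_mul_phase a q)
      (integrableOn_trigPolynomial_mul_phase b q), ha, hb]
    simp [mul_add]
  | single x r =>
    have h : ∀ θ : Fin d → ℝ, trigPolynomial θ (AddMonoidAlgebra.single x r) *
        Complex.exp (-(Complex.I * ((∑ i, (q i : ℝ) * θ i : ℝ) : ℂ))) =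
        r * Complex.exp (Complex.I * ((∑ i, ((x - q) i : ℤ) * θ i : ℝ) : ℂ)) := fun θ => by
      rw [trigPolynomial_single, mul_assoc, ← Complex.exp_add, ← sub_eq_add_neg, ← mul_sub,
        ← Complex.ofReal_sub, ← Finset.sum_sub_distrib]
      simp [sub_mul]
    simp_rw [h]
    rw [integral_const_mul, integral_periodCell_exp, AddMonoidAlgebra.coeff_single,
      Finsupp.single_apply, mul_comm]
    by_cases hxq : x = q
    · simp [hxq]
    · simp [hxq, sub_eq_zero]

/-- The characteristic function `(1/d) ∑ j, cos θ_j` of the simple random walk. -/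
noncomputable def walkSymbol (θ : Fin d → ℝ) : ℝ := (1 / (d : ℝ)) * ∑ j, Real.cos (θ j)

theorem symbolS_eq (θ : Fin d → ℝ) : symbolS θ = Real.log (1 - walkSymbol θ) := rfl

theorem continuous_walkSymbol : Continuous (walkSymbol (d := d)) := by
  unfold walkSymbol; fun_prop

theorem trigPolynomial_latticeStep (θ : Fin d → ℝ) :
    trigPolynomial θ (latticeStep d) = (walkSymbol θ : ℂ) := by
  simp only [latticeStep, map_sum, map_add, trigPolynomial_single, walkSymbol]
  push_cast
  rw [Finset.mul_sum]
  refine Finset.sum_congr rfl fun i _ => ?_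
  have h1 : ∑ j, (((Pi.single i 1 : Fin d → ℤ) j : ℤ) : ℂ) * (θ j : ℂ) = θ i := by
    simp [Pi.single_apply]
  have h2 : ∑ j, (((-Pi.single i 1 : Fin d → ℤ) j : ℤ) : ℂ) * (θ j : ℂ) = -θ i := by
    simp [Pi.single_apply]
  rw [h1, h2, Complex.cos, mul_neg, mul_comm Complex.I, neg_mul]
  rw [one_div, one_div, mul_inv]
  ring

theorem abs_walkSymbol_le (θ : Fin d → ℝ) : |walkSymbol θ| ≤ 1 := by
  rw [walkSymbol, abs_mul, abs_of_nonneg (by positivity : (0 : ℝ) ≤ 1 / d)]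
  have h : |∑ j, Real.cos (θ j)| ≤ d := by
    calc _ ≤ ∑ j : Fin d, |Real.cos (θ j)| := Finset.abs_sum_le_sum_abs _ _
      _ ≤ ∑ _j : Fin d, (1 : ℝ) := Finset.sum_le_sum fun j _ => Real.abs_cos_le_one _
      _ = d := by simp
  calc _ ≤ 1 / (d : ℝ) * d := mul_le_mul_of_nonneg_left h (by positivity)
    _ ≤ 1 := by rw [one_div]; exact inv_mul_le_one

theorem walkSymbol_lt_one (hd : 0 < d) {θ : Fin d → ℝ} (hθ : θ ∈ periodCell d) (h0 : θ ≠ 0) :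
    walkSymbol θ < 1 := by
  obtain ⟨i, hi⟩ := Function.ne_iff.mp h0
  have hcos : Real.cos (θ i) < 1 := by
    refine lt_of_le_of_ne (Real.cos_le_one _) fun h => hi ?_
    have h1 : -Real.pi ≤ θ i := hθ.1 i
    have h2 : θ i ≤ Real.pi := hθ.2 i
    exact (Real.cos_eq_one_iff_of_lt_of_lt (by linarith [Real.pi_pos])
      (by linarith [Real.pi_pos])).mp h
  have hd' : (0 : ℝ) < d := by exact_mod_cast hd
  have hsum : ∑ j, Real.cos (θ j) < ∑ _j : Fin d, (1 : ℝ) :=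
    Finset.sum_lt_sum (fun j _ => Real.cos_le_one _) ⟨i, Finset.mem_univ i, hcos⟩
  rw [walkSymbol, one_div, inv_mul_lt_iff₀ hd']
  simpa using hsum

theorem ae_walkSymbol_lt_one (hd : 0 < d) :
    ∀ᵐ θ ∂(volume.restrict (periodCell d)), walkSymbol θ < 1 := by
  have : Nonempty (Fin d) := ⟨⟨0, hd⟩⟩
  rw [ae_restrict_iff' (isCompact_periodCell d).measurableSet]
  have h0 : ∀ᵐ θ : Fin d → ℝ, θ ≠ 0 := by
    rw [ae_iff]
    simp
  filter_upwards [h0] with θ h0 hθ using walkSymbol_lt_one hd hθ h0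

/-- The Fourier coefficients of `log (1 - r φ)`, for `φ` the characteristic function of the simple
random walk. -/
theorem integral_log_one_sub_mul_walkSymbol {r : ℝ} (hr0 : 0 ≤ r) (hr : r < 1) (q : Fin d → ℤ) :
    ∫ θ in periodCell d, (Real.log (1 - r * walkSymbol θ) : ℂ) *
      Complex.exp (-(Complex.I * ((∑ i, (q i : ℝ) * θ i : ℝ) : ℂ))) =
    (((2 * Real.pi) ^ d * -∑' n : ℕ, (latticeStep d ^ n).coeff q / n * r ^ n : ℝ) : ℂ) := by
  set F : ℕ → (Fin d → ℝ) → ℂ := fun n θ => ((r ^ n / n : ℝ) : ℂ) *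
    (trigPolynomial θ (latticeStep d ^ n) *
      Complex.exp (-(Complex.I * ((∑ i, (q i : ℝ) * θ i : ℝ) : ℂ)))) with hF
  have hint : ∀ n, Integrable (F n) (volume.restrict (periodCell d)) := fun n =>
    (integrableOn_trigPolynomial_mul_phase _ q).const_mul _
  have hnorm : ∀ n θ, ‖F n θ‖ ≤ r ^ n := fun n θ => by
    rw [hF, norm_mul, norm_mul, norm_torusPhase, map_pow, trigPolynomial_latticeStep, norm_pow,
      Complex.norm_real, Complex.norm_real, Real.norm_eq_abs, Real.norm_eq_abs, mul_one,
      abs_of_nonneg (by positivity)]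
    have h1 : |walkSymbol θ| ^ n ≤ 1 := pow_le_one₀ (abs_nonneg _) (abs_walkSymbol_le θ)
    have h2 : r ^ n / n ≤ r ^ n := by
      rcases n.eq_zero_or_pos with rfl | hn
      · simp
      · exact div_le_self (by positivity) (by exact_mod_cast hn)
    exact (mul_le_of_le_one_right (by positivity) h1).trans h2
  have hsum : Summable fun n => ∫ θ in periodCell d, ‖F n θ‖ := by
    refine Summable.of_nonneg_of_le (fun n => integral_nonneg fun _ => norm_nonneg _) (fun n => ?_)
      ((summable_geometric_of_lt_one hr0 hr).mul_right (volume.real (periodCell d)))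
    have := norm_setIntegral_le_of_norm_le_const (μ := volume) (s := periodCell d)
      (f := fun θ => ‖F n θ‖) (C := r ^ n)
      (isCompact_periodCell d).measure_lt_top (fun θ _ => by rw [norm_norm]; exact hnorm n θ)
    exact (le_abs_self _).trans this
  have hpt : ∀ θ : Fin d → ℝ, ∑' n, F n θ = -((Real.log (1 - r * walkSymbol θ) : ℂ) *
      Complex.exp (-(Complex.I * ((∑ i, (q i : ℝ) * θ i : ℝ) : ℂ)))) := fun θ => by
    have hx : |r * walkSymbol θ| < 1 := by
      rw [abs_mul, abs_of_nonneg hr0]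
      exact (mul_le_of_le_one_right hr0 (abs_walkSymbol_le θ)).trans_lt hr
    have h1 := Real.hasSum_pow_div_log_of_abs_lt_one hx
    have h2 : HasSum (fun n : ℕ => (r * walkSymbol θ) ^ n / n)
        (-Real.log (1 - r * walkSymbol θ)) := by
      -- The logarithm series is indexed by `n + 1`; the added term `n = 0` is `1 / 0 = 0`.
      refine (hasSum_nat_add_iff' 1).mp ?_
      simpa using h1
    have h3 := (Complex.hasSum_ofReal.mpr h2).mul_right
      (Complex.exp (-(Complex.I * ((∑ i, (q i : ℝ) * θ i : ℝ) : ℂ))))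
    rw [Complex.ofReal_neg, neg_mul] at h3
    rw [← h3.tsum_eq]
    refine tsum_congr fun n => ?_
    rw [hF]
    simp only [map_pow, trigPolynomial_latticeStep]
    push_cast
    ring
  have key := hasSum_integral_of_summable_integral_norm hint hsum
  simp_rw [hpt] at key
  rw [integral_neg] at key
  have hterm : ∀ n, ∫ θ in periodCell d, F n θ =
      (((2 * Real.pi) ^ d * ((latticeStep d ^ n).coeff q / n * r ^ n) : ℝ) : ℂ) := fun n => by
    simp only [hF]
    rw [integral_const_mul, integral_trigPolynomial_mul_phase]
    push_cast
    ring
  simp_rw [hterm] at key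
  rw [← neg_eq_iff_eq_neg.mpr key.tsum_eq, ← Complex.ofReal_tsum, tsum_mul_left,
    ← Complex.ofReal_neg, mul_neg]

end Fourier

/-! ### The limit `r → 1` and the sum over the Diophantine lattice -/

section FourierLimit
open Filter Topology

variable {d : ℕ}

theorem coeff_latticeStep_nonneg (q : Fin d → ℤ) : 0 ≤ (latticeStep d).coeff q := by
  rw [latticeStep, AddMonoidAlgebra.coeff_sum, Finsupp.finsetSum_apply]
  refine Finset.sum_nonneg fun i _ => ?_
  rw [AddMonoidAlgebra.coeff_add, Finsupp.add_apply, AddMonoidAlgebra.coeff_single,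
    AddMonoidAlgebra.coeff_single, Finsupp.single_apply, Finsupp.single_apply]
  split_ifs <;> positivity

theorem coeff_latticeStep_pow_div_nonneg (n : ℕ) (q : Fin d → ℤ) :
    0 ≤ (latticeStep d ^ n).coeff q / n :=
  div_nonneg (coeff_pow_nonneg coeff_latticeStep_nonneg n q) n.cast_nonneg

theorem one_sub_mul_walkSymbol_pos {r : ℝ} (hr0 : 0 ≤ r) (hr : r < 1) (θ : Fin d → ℝ) :
    0 < 1 - r * walkSymbol θ := by
  have := (le_abs_self (walkSymbol θ)).trans (abs_walkSymbol_le θ)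
  have := mul_le_of_le_one_right hr0 this
  linarith

theorem one_sub_mul_walkSymbol_le {r : ℝ} (hr0 : 0 ≤ r) (hr : r ≤ 1) (θ : Fin d → ℝ) :
    1 - r * walkSymbol θ ≤ 2 := by
  have := (neg_le_abs (walkSymbol θ)).trans (abs_walkSymbol_le θ)
  have := mul_le_of_le_one_right hr0 this
  linarith

/-- The number `1 - r x` lies between `1` and `1 - x`. This provides `|S|` as a dominating function
for the limit `r → 1`. -/
theorem abs_log_one_sub_mul_le {r x : ℝ} (hr0 : 0 ≤ r) (hr : r ≤ 1) (hx : x < 1) :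
    |Real.log (1 - r * x)| ≤ |Real.log (1 - x)| := by
  rcases le_or_gt 0 x with h | h
  · have h1 : r * x ≤ x := mul_le_of_le_one_left h hr
    have h2 : 0 ≤ r * x := mul_nonneg hr0 h
    rw [abs_of_nonpos (Real.log_nonpos (by linarith) (by linarith)),
      abs_of_nonpos (Real.log_nonpos (by linarith) (by linarith))]
    exact neg_le_neg (Real.log_le_log (by linarith) (by linarith))
  · have h1 : x ≤ r * x := by nlinarith
    have h2 : r * x ≤ 0 := mul_nonpos_of_nonneg_of_nonpos hr0 h.le
    rw [abs_of_nonneg (Real.log_nonneg (by linarith)), abs_of_nonneg (Real.log_nonneg (by linarith))]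
    exact Real.log_le_log (by linarith) (by linarith)

theorem tendsto_log_one_sub_mul {x : ℝ} (hx : x < 1) :
    Tendsto (fun r : ℝ => Real.log (1 - r * x)) (𝓝[<] 1) (𝓝 (Real.log (1 - x))) := by
  have h : ContinuousAt (fun r : ℝ => Real.log (1 - r * x)) 1 := by
    refine ContinuousAt.log (by fun_prop) ?_
    rw [one_mul]
    exact (sub_pos.mpr hx).ne'
  simpa using h.tendsto.mono_left nhdsWithin_le_nhds

theorem continuous_log_one_sub_mul_walkSymbol {r : ℝ} (hr0 : 0 ≤ r) (hr : r < 1) :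
    Continuous fun θ : Fin d → ℝ => Real.log (1 - r * walkSymbol θ) :=
  Continuous.log (by have := continuous_walkSymbol (d := d); fun_prop)
    fun θ => (one_sub_mul_walkSymbol_pos hr0 hr θ).ne'

theorem integral_log_one_sub_mul_walkSymbol_zero {r : ℝ} (hr0 : 0 ≤ r) (hr : r < 1) :
    ∫ θ in periodCell d, Real.log (1 - r * walkSymbol θ) =
      (2 * Real.pi) ^ d * -∑' n : ℕ, (latticeStep d ^ n).coeff 0 / n * r ^ n := by
  have h := integral_log_one_sub_mul_walkSymbol hr0 hr (0 : Fin d → ℤ)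
  simp only [Pi.zero_apply, Int.cast_zero, zero_mul, Finset.sum_const_zero, Complex.ofReal_zero,
    mul_zero, neg_zero, Complex.exp_zero, mul_one] at h
  rw [integral_complex_ofReal] at h
  exact_mod_cast h

theorem measurable_symbolS : Measurable (symbolS (d := d)) :=
  Real.measurable_log.comp (measurable_const.sub continuous_walkSymbol.measurable)

/-- Integrability of the symbol, from the summability of the weighted return probabilities of the
simple random walk, by Fatou's lemma. -/
theorem integrableOn_symbolS (hd : 0 < d)
    (hs : Summable fun n : ℕ => (latticeStep d ^ n).coeff 0 / n) :
    IntegrableOn (symbolS (d := d)) (periodCell d) := by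
  set ν := volume.restrict (periodCell d) with hν
  have : IsFiniteMeasure ν := ⟨by
    rw [hν, Measure.restrict_apply_univ]; exact (isCompact_periodCell d).measure_lt_top⟩
  -- Since `1 - r φ ≤ 2`, subtracting the logarithm from `log 2` gives the nonnegative functions
  -- that Fatou's lemma needs.
  have hnn : ∀ r : ℝ, 0 ≤ r → r ≤ 1 → ∀ θ : Fin d → ℝ, walkSymbol θ < 1 →
      0 ≤ Real.log 2 - Real.log (1 - r * walkSymbol θ) := fun r h0 h1 θ hθ => by
    have h2 : 0 < 1 - r * walkSymbol θ := by
      rcases le_or_gt 0 (walkSymbol θ) with h | h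
      · have := mul_le_of_le_one_left h h1
        linarith
      · have := mul_nonpos_of_nonneg_of_nonpos h0 h.le
        linarith
    exact sub_nonneg.mpr (Real.log_le_log h2 (one_sub_mul_walkSymbol_le h0 h1 θ))
  set B : ℝ := (2 * Real.pi) ^ d * (Real.log 2 + ∑' n : ℕ, (latticeStep d ^ n).coeff 0 / n)
  have hmeas : ∀ r : ℝ, Measurable fun θ : Fin d → ℝ =>
      ENNReal.ofReal (Real.log 2 - Real.log (1 - r * walkSymbol θ)) := fun r => by
    have := (continuous_walkSymbol (d := d)).measurable
    fun_prop
  have hbound : ∀ r : ℝ, r ∈ Set.Ioo (0 : ℝ) 1 →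
      ∫⁻ θ, ENNReal.ofReal (Real.log 2 - Real.log (1 - r * walkSymbol θ)) ∂ν ≤
        ENNReal.ofReal B := fun r hr => by
    have hint : IntegrableOn (fun θ : Fin d → ℝ => Real.log (1 - r * walkSymbol θ))
        (periodCell d) :=
      (continuous_log_one_sub_mul_walkSymbol hr.1.le hr.2).continuousOn.integrableOn_compact
        (isCompact_periodCell d)
    have hsub : Integrable (fun θ : Fin d → ℝ =>
        Real.log 2 - Real.log (1 - r * walkSymbol θ)) ν := (integrable_const _).sub hint
    rw [← ofReal_integral_eq_lintegral_ofReal hsub]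
    · refine ENNReal.ofReal_le_ofReal ?_
      have h1 : ∑' n : ℕ, (latticeStep d ^ n).coeff 0 / n * r ^ n ≤
          ∑' n : ℕ, (latticeStep d ^ n).coeff 0 / n := by
        have hle : ∀ n : ℕ, (latticeStep d ^ n).coeff 0 / n * r ^ n ≤
            (latticeStep d ^ n).coeff 0 / n := fun n =>
          mul_le_of_le_one_right (coeff_latticeStep_pow_div_nonneg n 0)
            (pow_le_one₀ hr.1.le hr.2.le)
        refine Summable.tsum_le_tsum hle (Summable.of_nonneg_of_le (fun n => ?_) hle hs) hs
        exact mul_nonneg (coeff_latticeStep_pow_div_nonneg n 0) (pow_nonneg hr.1.le n)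
      have h2 := integral_log_one_sub_mul_walkSymbol_zero (d := d) hr.1.le hr.2
      rw [integral_sub (integrable_const _) hint, h2, integral_const,
        measureReal_restrict_apply_univ, volume_periodCell, smul_eq_mul, ← mul_sub, sub_neg_eq_add]
      exact mul_le_mul_of_nonneg_left (by linarith) (by positivity)
    · filter_upwards [ae_walkSymbol_lt_one hd] with θ hθ using hnn r hr.1.le hr.2.le θ hθ
  have hlim : ∀ᵐ θ ∂ν, liminf (fun r : ℝ =>
      ENNReal.ofReal (Real.log 2 - Real.log (1 - r * walkSymbol θ))) (𝓝[<] 1) =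
      ENNReal.ofReal (Real.log 2 - symbolS θ) := by
    filter_upwards [ae_walkSymbol_lt_one hd] with θ hθ
    exact (ENNReal.tendsto_ofReal
      (tendsto_const_nhds.sub (tendsto_log_one_sub_mul hθ))).liminf_eq
  have hfin : ∫⁻ θ, ENNReal.ofReal (Real.log 2 - symbolS θ) ∂ν ≤ ENNReal.ofReal B := by
    rw [← lintegral_congr_ae hlim]
    refine (lintegral_liminf_le hmeas).trans (liminf_le_of_frequently_le' ?_)
    refine Eventually.frequently ?_
    filter_upwards [Ioo_mem_nhdsLT (show (0 : ℝ) < 1 by norm_num)] with r hr using hbound r hr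
  have hg : Integrable (fun θ : Fin d → ℝ => Real.log 2 - symbolS θ) ν := by
    refine ⟨(measurable_const.sub measurable_symbolS).aestronglyMeasurable, ?_⟩
    rw [hasFiniteIntegral_iff_ofReal]
    · exact hfin.trans_lt ENNReal.ofReal_lt_top
    · filter_upwards [ae_walkSymbol_lt_one hd] with θ hθ
      simpa [symbolS_eq] using hnn 1 zero_le_one le_rfl θ hθ
  exact ((integrable_const (Real.log 2)).sub hg).congr (ae_of_all _ fun θ => by simp)

/-- The Fourier coefficients of the symbol in terms of the transition probabilities of the simple
random walk. -/
theorem symbolSHat_eq (hd : 0 < d) (hs0 : Summable fun n : ℕ => (latticeStep d ^ n).coeff 0 / n)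
    {q : Fin d → ℤ} (hs : Summable fun n : ℕ => (latticeStep d ^ n).coeff q / n) :
    symbolSHat q = -∑' n : ℕ, (latticeStep d ^ n).coeff q / n := by
  set e : (Fin d → ℝ) → ℂ := fun θ =>
    Complex.exp (-(Complex.I * ((∑ i, (q i : ℝ) * θ i : ℝ) : ℂ))) with he
  have hlim : Tendsto (fun r : ℝ => ∫ θ in periodCell d,
      (Real.log (1 - r * walkSymbol θ) : ℂ) * e θ) (𝓝[<] 1)
      (𝓝 (∫ θ in periodCell d, (symbolS θ : ℂ) * e θ)) := by
    refine tendsto_integral_filter_of_dominated_convergence (fun θ => |symbolS θ|) ?_ ?_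
      (integrableOn_symbolS hd hs0).abs ?_
    · filter_upwards [Ioo_mem_nhdsLT (show (0 : ℝ) < 1 by norm_num)] with r hr
      exact ((Complex.continuous_ofReal.comp
        (continuous_log_one_sub_mul_walkSymbol hr.1.le hr.2)).mul
          (continuous_torusPhase q)).aestronglyMeasurable
    · filter_upwards [Ioo_mem_nhdsLT (show (0 : ℝ) < 1 by norm_num)] with r hr
      filter_upwards [ae_walkSymbol_lt_one hd] with θ hθ
      rw [norm_mul, he, norm_torusPhase, mul_one, Complex.norm_real, Real.norm_eq_abs, symbolS_eq]
      exact abs_log_one_sub_mul_le hr.1.le hr.2.le hθ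
    · filter_upwards [ae_walkSymbol_lt_one hd] with θ hθ
      exact ((Complex.continuous_ofReal.tendsto _).comp (tendsto_log_one_sub_mul hθ)).mul_const _
  have hlim2 : Tendsto (fun r : ℝ => ∫ θ in periodCell d,
      (Real.log (1 - r * walkSymbol θ) : ℂ) * e θ) (𝓝[<] 1)
      (𝓝 (((2 * Real.pi) ^ d * -∑' n : ℕ, (latticeStep d ^ n).coeff q / n : ℝ) : ℂ)) := by
    -- Abel's theorem, available because the series converges at `r = 1`.
    have h := Real.tendsto_tsum_powerSeries_nhdsWithin_lt hs.hasSum.tendsto_sum_nat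
    refine ((Complex.continuous_ofReal.tendsto _).comp
      (h.neg.const_mul ((2 * Real.pi) ^ d))).congr' ?_
    filter_upwards [Ioo_mem_nhdsLT (show (0 : ℝ) < 1 by norm_num)] with r hr
    exact (integral_log_one_sub_mul_walkSymbol hr.1.le hr.2 q).symm
  have h := tendsto_nhds_unique hlim hlim2
  have hpi : (2 * Real.pi) ^ d ≠ 0 := by positivity
  rw [symbolSHat, torusFourierCoeff, h, ← Complex.ofReal_inv, ← Complex.ofReal_mul,
    Complex.ofReal_re, inv_mul_cancel_left₀ hpi]

/-- The fibre of `x ↦ p · x` over `0` is the Diophantine lattice, so its total mass is the atom at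
`0` of the projected measure. -/
theorem hasSum_coeff_diophantineLattice (p : EuclideanSpace ℝ (Fin d))
    (a : AddMonoidAlgebra ℝ (Fin d → ℤ)) :
    HasSum (fun q : diophantineLattice p => a.coeff (q : Fin d → ℤ))
      ((AddMonoidAlgebra.mapDomainRingHom ℝ (latticeDotHom p) a).coeff 0) := by
  induction a using AddMonoidAlgebra.induction_linear with
  | zero => simp
  | add a b ha hb => rw [map_add]; exact ha.add hb
  | single x r =>
    rw [AddMonoidAlgebra.mapDomainRingHom_apply, AddMonoidAlgebra.mapDomain_single,
      AddMonoidAlgebra.coeff_single, AddMonoidAlgebra.coeff_single, latticeDotHom_apply]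
    by_cases hx : latticeDot p x = 0
    · rw [hx, Finsupp.single_eq_same]
      have h := hasSum_single (f := fun q : diophantineLattice p =>
        Finsupp.single x r (q : Fin d → ℤ)) ⟨x, hx⟩ fun q hq =>
          Finsupp.single_eq_of_ne fun h => hq (Subtype.ext h)
      simpa using h
    · rw [Finsupp.single_eq_of_ne (Ne.symm hx)]
      refine hasSum_zero.congr_fun fun q => ?_
      exact Finsupp.single_eq_of_ne fun h => hx (h ▸ q.2)

theorem hasSum_symbolSHat {p : EuclideanSpace ℝ (Fin d)} (hp : p ≠ 0) :
    HasSum (fun q : diophantineLattice p => symbolSHat (q : Fin d → ℤ))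
      (-∑' n : ℕ, (projectedStep p ^ n).coeff 0 / n) ∧
    IntegrableOn (symbolS (d := d)) (periodCell d) := by
  set F : ℕ × diophantineLattice p → ℝ := fun x =>
    (latticeStep d ^ x.1).coeff (x.2 : Fin d → ℤ) / x.1 with hF
  have hrow : ∀ n : ℕ, HasSum (fun q => F (n, q)) ((projectedStep p ^ n).coeff 0 / n) :=
    fun n => by
      have h := hasSum_coeff_diophantineLattice p (latticeStep d ^ n)
      rw [map_pow] at h
      exact h.div_const _
  -- The terms are nonnegative, the row sums are `P(S_n = 0) / n`, and these are summable by the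
  -- positivity of the ladder mean.
  have hFs : Summable F := by
    refine (summable_prod_of_nonneg fun x => coeff_latticeStep_pow_div_nonneg x.1 _).mpr
      ⟨fun n => (hrow n).summable, ?_⟩
    exact (summable_projectedStep_atom_div hp).congr fun n => (hrow n).tsum_eq.symm
  have hcol : ∀ q : diophantineLattice p, Summable fun n : ℕ =>
      (latticeStep d ^ n).coeff (q : Fin d → ℤ) / n := fun q =>
    hFs.comp_injective (i := fun n => (n, q)) fun a b h => congrArg Prod.fst h
  -- The column `q = 0` gives summability of the weighted return probabilities of the lattice walk,
  -- hence integrability of `S`, in every dimension and without estimating `S` near its singularity.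
  have h0 := hcol ⟨0, latticeDot_zero p⟩
  have hval : ∀ q : diophantineLattice p, symbolSHat (q : Fin d → ℤ) = -∑' n, F (n, q) :=
    fun q => symbolSHat_eq (dim_pos hp) h0 (hcol q)
  refine ⟨?_, integrableOn_symbolS (dim_pos hp) h0⟩
  simp_rw [hval]
  have htot : ∑' x, F x = ∑' n : ℕ, (projectedStep p ^ n).coeff 0 / n := by
    rw [hFs.tsum_prod]
    exact tsum_congr fun n => (hrow n).tsum_eq
  rw [← htot]
  have hswap := hFs.hasSum
  rw [← (Equiv.prodComm _ _).hasSum_iff] at hswap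
  exact (hswap.prod_fiberwise fun q => (hcol q).hasSum).neg

end FourierLimit

theorem theoremt (d : ℕ) (p : EuclideanSpace ℝ (Fin d)) (hp : p ≠ 0) :
    (∃! u : (Fin d → ℤ) → ℝ, IsHalfSpaceSolution p u) ∧
    IntegrableOn (symbolS (d := d)) (periodCell d) volume ∧
    Summable (fun q : diophantineLattice p => symbolSHat (q : Fin d → ℤ)) ∧
    hamiltonian p ^ 2 =
      2 * (d : ℝ) * Real.exp (∑' q : diophantineLattice p, symbolSHat (q : Fin d → ℤ)) *
        ‖p‖ ^ 2 := by
  obtain ⟨hsum, hint⟩ := hasSum_symbolSHat hp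
  exact ⟨existsUnique_isHalfSpaceSolution hp, hint, hsum.summable, by
    rw [hsum.tsum_eq]; exact hamiltonian_sq hp⟩
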